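/- **Lemma (Accuracy of the low-dimensional model).** *Network.* $N$ agents are connected by an undirected graph; $\mathcal N_k$ is the neighborhood of agent $k$ ($k\in\mathcal N_k$). Agent $k$ has a cost $J_k:\mathbb R^M\to\mathbb R$ with minimizer $w_k^o$. The agents are partitioned into clusters according to their minimizers (two agents are in the same cluster iff $w_k^o=w_\ell^o$), and into groups $\mathcal G_1,\dots,\mathcal G_G$, each contained in one cluster; every cluster and every group is connected. Let $A=[a_{\ell k}]$ satisfy $a_{\ell k}>0$ if $k,\ell$ are in the same group and $\ell\in\mathcal N_k$, $a_{\ell k}=0$ otherwise, and $\sum_\ell a_{\ell k}=1$. Let $A_m$ be the diagonal block of $A$ for $\mathcal G_m$, $N_m=|\mathcal G_m|$, and $p_m=\mathrm{col}\{p_k;k\in\mathcal G_m\}$ its Perron vector: $A_mp_m=p_m$, $\mathbf 1^{\mathsf T}p_m=1$. *Costs.* Each $J_k$ is strictly convex and twice differentiable with $\lambda_{k,L}I\le\nabla^2J_k(w)\le\lambda_{k,U}I$ for all $w$, $0\le\lambda_{k,L}\le\lambda_{k,U}<\infty$; every group contains an agent with $\lambda_{k,L}>0$; and $\nabla^2J(\mathcal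 W)=\mathrm{diag}\{\nabla^2J_k(w_k)\}$ is Lipschitz in $\mathcal W=\mathrm{col}\{w_k\}\in\mathbb R^{NM}$ for the matrix 2-norm. *Noise.* On a filtered probability space, $\widehat{\nabla J_k}$ (at time $i$) is a random approximation of the map $\nabla J_k$; let $\boldsymbol{\mathcal S}_i(\mathcal W)=\mathrm{col}\{\widehat{\nabla J_k}(w_k)-\nabla J_k(w_k)\}$ and $\mathcal W^o=\mathrm{col}\{w_k^o\}$. For every $\mathbb F_{i-1}$-measurable random vector $\boldsymbol{\mathcal W}$, $\boldsymbol{\mathcal S}_i(\boldsymbol{\mathcal W})$ is $\mathbb F_i$-measurable. For every such $\boldsymbol{\mathcal W}$ that has a finite fourth moment, with $\mathcal R_{s,i}(\boldsymbol{\mathcal W})=\mathbb E[\boldsymbol{\mathcal S}_i(\boldsymbol{\mathcal W})\boldsymbol{\mathcal S}_i(\boldsymbol{\mathcal W})^{\mathsf T}|\mathbb F_{i-1}]$, almost surely: $\mathbb E[\boldsymbol{\mathcal S}_i(\boldsymbol{\mathcal W})|\mathbb F_{i-1}]=0$; $\mathbb E[\|\boldsymbol{\mathcal S}_i(\boldsymbol{\mathcal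 W})\|^4|\mathbb F_{i-1}]\le\alpha^2\|\mathcal W^o-\boldsymbol{\mathcal W}\|^4+\sigma_s^4$ (so $\boldsymbol{\mathcal S}_i(\boldsymbol{\mathcal W})$ has a finite fourth moment); $\|\mathcal R_{s,i}(\mathcal W^o)-\mathcal R_{s,i}(\boldsymbol{\mathcal W})\|\le\kappa_s\|\mathcal W^o-\boldsymbol{\mathcal W}\|^{\gamma_s}$. Here $\alpha,\sigma_s,\kappa_s\ge0$ and $0<\gamma_s\le4$ do not depend on $i$ and $\boldsymbol{\mathcal W}$. Moreover $\mathcal R_{s,i}(\mathcal W^o)\to\mathcal R_s$ almost surely as $i\to\infty$, for some deterministic positive definite $\mathcal R_s$. *Recursions.* For step-sizes $\mu_k>0$ put $\mu_{\max}=\max_k\mu_k$, $\mathcal A=A\otimes I_M$, $\mathcal M=\mathrm{diag}\{\mu_k\}\otimes I_M$, $H_k=\nabla^2J_k(w_k^o)$, $\mathcal H=\mathrm{diag}\{H_k\}$, $\mathcal B=\mathcal A^{\mathsf T}(I-\mathcal M\mathcal H)$, $\bar H_m=\sum_{k\in\mathcal G_m}\frac{p_k\mu_k}{\mu_{\max}}H_k$,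 $\mathcal D=\mathrm{diag}\{I_M-\mu_{\max}\bar H_m\}_{m=1}^G$, $\mathcal P=\mathrm{diag}\{p_1,\dots,p_G\}\otimes I_M$ (agents ordered by groups). For $i\ge0$ let $\boldsymbol{\mathcal W}_i=\mathrm{col}\{\boldsymbol w_{k,i}\}$ be generated by $$\boldsymbol\psi_{k,i}=\boldsymbol w_{k,i-1}-\mu_k\widehat{\nabla J_k}(\boldsymbol w_{k,i-1}),\qquad \boldsymbol w_{k,i}=\sum_{\ell}a_{\ell k}\boldsymbol\psi_{\ell,i},$$ and let the long-term and the low-dimensional (centroid) models be $$\widetilde{\boldsymbol{\mathcal W}}{}_i^{\rm long}=\mathcal B\,\widetilde{\boldsymbol{\mathcal W}}{}_{i-1}^{\rm long}+\mathcal A^{\mathsf T}\mathcal M\boldsymbol{\mathcal S}_i(\boldsymbol{\mathcal W}_{i-1})\in\mathbb R^{NM},\qquad \widetilde{\boldsymbol{\mathcal W}}{}_i^{\rm low}=\mathcal D\,\widetilde{\boldsymbol{\mathcal W}}{}_{i-1}^{\rm low}+\mathcal P^{\mathsf T}\mathcal M\boldsymbol{\mathcal S}_i(\boldsymbol{\mathcal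 W}_{i-1})\in\mathbb R^{GM},$$ where $\boldsymbol{\mathcal W}_{-1}$ is $\mathbb F_{-1}$-measurable with a finite fourth moment, and the initial states of the two models are random vectors with finite second moments. Write $\widetilde{\boldsymbol{\mathcal W}}{}_i^{\rm low}=\mathrm{col}\{\widetilde{\boldsymbol w}{}_{1,i}^{\rm low},\dots,\widetilde{\boldsymbol w}{}_{G,i}^{\rm low}\}$ and $\bar{\boldsymbol{\mathcal W}}{}_i^{\rm low}=\mathrm{col}\{\mathbf 1_{N_m}\otimes\widetilde{\boldsymbol w}{}_{m,i}^{\rm low};\ m=1,\dots,G\}\in\mathbb R^{NM}$. *Claim.* For sufficiently small step-sizes of comparable size, $$\limsup_{i\to\infty}\mathbb E\big\|\widetilde{\boldsymbol{\mathcal W}}{}_i^{\rm long}-\bar{\boldsymbol{\mathcal W}}{}_i^{\rm low}\big\|^2=O(\mu_{\max}^2).$$ That is: for every $\tau>0$ there are $\mu_0>0$ and $C\ge0$ such that for all step-sizes $\mu_k>0$ with $\mu_{\max}\le\mu_0$ and $\mu_k\ge\tau\mu_{\max}$ for all $k$, and all initial states as above, the limit superior is at most $C\mu_{\max}^2$.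 -/

import Mathlib

open MeasureTheory ProbabilityTheory Filter Topology

noncomputable section

namespace ClusterNet

/-- Parameter vectors `w ∈ ℝ^M` with the Euclidean norm. -/
abbrev Param (M : ℕ) := EuclideanSpace ℝ (Fin M)

/-- Stacked vectors `col{x_1, …, x_n}` of `n` blocks `x_k ∈ ℝ^M`, with the Euclidean norm of
`ℝ^{nM}` (`‖x‖² = ∑_k ‖x_k‖²`). Used with `n = N` (agents) and `n = G` (groups). -/
abbrev Stack (n M : ℕ) := PiLp 2 (fun _ : Fin n => Param M)

/-- The stacked vector with the given blocks. -/
def col {n M : ℕ} (x : Fin n → Param M) : Stack n M := WithLp.toLp 2 x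

/-! ### Topology, clusters, groups, combination weights -/

/-- The network is an undirected graph `Gr` on the agents. Agents are partitioned into clusters
according to their minimizers `wo k`, and every cluster is connected. Groups are connected sets of
agents that partition the network, every group lying inside one cluster. -/
structure TopologyAssumption {N Q G M : ℕ} (Gr : SimpleGraph (Fin N)) (wo : Fin N → Param M)
    (cluster : Fin N → Fin Q) (group : Fin N → Fin G) : Prop where
  cluster_iff : ∀ k l, cluster k = cluster l ↔ wo k = wo l
  cluster_connected : ∀ q, (Gr.induce {k | cluster k = q}).Connected
  group_connected : ∀ m, (Gr.induce {k | group k = m}).Connected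
  group_le_cluster : ∀ k l, group k = group l → cluster k = cluster l

/-- `A l k` is the weight `a_{lk}` that agent `k` gives to agent `l`: positive exactly when `l` is
in the group of `k` and in the neighborhood of `k` (which contains `k` itself), with unit column
sums. -/
structure IsCombinationMatrix {N G : ℕ} (Gr : SimpleGraph (Fin N)) (group : Fin N → Fin G)
    (A : Matrix (Fin N) (Fin N) ℝ) : Prop where
  pos : ∀ l k, group l = group k → (l = k ∨ Gr.Adj l k) → 0 < A l k
  zero : ∀ l k, ¬ (group l = group k ∧ (l = k ∨ Gr.Adj l k)) → A l k = 0
  col_sum : ∀ k, ∑ l, A l k = 1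

/-- `p` is the stacked Perron vector: within every group it is the right eigenvector of that
group's (diagonal) block of `A` at the eigenvalue one, with entries adding up to one. -/
structure IsPerronVector {N G : ℕ} (group : Fin N → Fin G) (A : Matrix (Fin N) (Fin N) ℝ)
    (p : Fin N → ℝ) : Prop where
  eigen : ∀ k, ∑ l with group l = group k, A k l * p l = p k
  sum_one : ∀ m, ∑ k with group k = m, p k = 1

/-! ### Costs -/

/-- The Hessian `∇²J(w)` as an operator on `ℝ^M`. -/
def hess {M : ℕ} (J : Param M → ℝ) (w : Param M) : Param M →L[ℝ] Param M :=
  fderiv ℝ (gradient J) w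

/-- The block-diagonal operator `diag{T_1, …, T_n}`. -/
def blockDiag {n M : ℕ} (T : Fin n → (Param M →L[ℝ] Param M)) : Stack n M →L[ℝ] Stack n M :=
  { toFun := fun x => col fun k => T k (x k)
    map_add' := fun x y => by ext k : 1; simp only [col, PiLp.add_apply, map_add]
    map_smul' := fun c x => by ext k : 1; simp only [col, PiLp.smul_apply, map_smul, RingHom.id_apply]
    cont := (PiLp.continuous_toLp 2 _).comp (continuous_pi fun k =>
      (T k).continuous.comp (PiLp.continuous_apply 2 _ k)) }

/-- The network Hessian `diag{∇²J_1(w_1), …, ∇²J_N(w_N)}`. -/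
def netHess {N M : ℕ} (J : Fin N → Param M → ℝ) (W : Stack N M) : Stack N M →L[ℝ] Stack N M :=
  blockDiag fun k => hess (J k) (W k)

/-- Assumptions on the individual costs `J k`, with minimizers `wo k`. -/
structure CostAssumption {N G M : ℕ} (J : Fin N → Param M → ℝ) (wo : Fin N → Param M)
    (group : Fin N → Fin G) : Prop where
  minimizer : ∀ k w, J k (wo k) ≤ J k w
  strictConvex : ∀ k, StrictConvexOn ℝ Set.univ (J k)
  differentiable : ∀ k, Differentiable ℝ (J k)
  twice_differentiable : ∀ k, Differentiable ℝ (gradient (J k))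
  /-- `λ_{k,L} I ≤ ∇²J_k ≤ λ_{k,U} I`, with a positive `λ_{k,L}` somewhere in each group. -/
  hess_bounds : ∃ lamL lamU : Fin N → ℝ,
    (∀ k, 0 ≤ lamL k ∧ lamL k ≤ lamU k) ∧
    (∀ k w v, lamL k * ‖v‖ ^ 2 ≤ inner ℝ (hess (J k) w v) v ∧
      inner ℝ (hess (J k) w v) v ≤ lamU k * ‖v‖ ^ 2) ∧
    (∀ m, ∃ k, group k = m ∧ 0 < lamL k)
  hess_lipschitz : ∃ kH : ℝ, 0 ≤ kH ∧
    ∀ W₁ W₂ : Stack N M, ‖netHess J W₁ - netHess J W₂‖ ≤ kH * ‖W₁ - W₂‖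

/-! ### Gradient noise

Time is shifted by one: index `n` of the filtration and of the iterates stands for the time
`n - 1`, so that `n = 0` is the initial time `-1`; `ghat n` is the stochastic gradient used in the
step from index `n` to index `n + 1`. -/

section Noise

variable {Ω : Type*} {N M : ℕ}

/-- The network gradient noise `𝒮(W) = col{ĝ_k(w_k) - ∇J_k(w_k)}`. -/
def noise (J : Fin N → Param M → ℝ) (ghat : ℕ → Ω → Fin N → Param M → Param M)
    (n : ℕ) (ω : Ω) (W : Stack N M) : Stack N M :=
  col fun k => ghat n ω k (W k) - gradient (J k) (W k)

/-- The conditional covariance `𝓡(W) = E[𝒮(W) 𝒮(W)ᵀ | 𝔽]`, an `NM × NM` random matrix. -/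
def condCov {mΩ : MeasurableSpace Ω} (P : Measure Ω) (F : Filtration ℕ mΩ)
    (J : Fin N → Param M → ℝ) (ghat : ℕ → Ω → Fin N → Param M → Param M)
    (n : ℕ) (W : Ω → Stack N M) (ω : Ω) : Matrix (Fin N × Fin M) (Fin N × Fin M) ℝ :=
  Matrix.of fun a b =>
    (P[fun ω' => noise J ghat n ω' (W ω') a.1 a.2 * noise J ghat n ω' (W ω') b.1 b.2 | F n]) ω

/-- Assumptions on the gradient noise, for every random vector `W` that is measurable with respect
to the past and has a finite fourth moment. -/
structure NoiseAssumption {mΩ : MeasurableSpace Ω} (P : Measure Ω) (F : Filtration ℕ mΩ)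
    (J : Fin N → Param M → ℝ) (wo : Fin N → Param M)
    (ghat : ℕ → Ω → Fin N → Param M → Param M) : Prop where
  adapted : ∀ (n : ℕ) (W : Ω → Stack N M), StronglyMeasurable[F n] W →
    StronglyMeasurable[F (n + 1)] fun ω => noise J ghat n ω (W ω)
  martingale_diff : ∀ (n : ℕ) (W : Ω → Stack N M), StronglyMeasurable[F n] W → MemLp W 4 P →
    P[fun ω => noise J ghat n ω (W ω) | F n] =ᵐ[P] 0
  fourth_moment : ∃ α σ : ℝ, 0 ≤ α ∧ 0 ≤ σ ∧
    ∀ (n : ℕ) (W : Ω → Stack N M), StronglyMeasurable[F n] W → MemLp W 4 P →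
      MemLp (fun ω => noise J ghat n ω (W ω)) 4 P ∧
      P[fun ω => ‖noise J ghat n ω (W ω)‖ ^ 4 | F n]
        ≤ᵐ[P] fun ω => α ^ 2 * ‖col wo - W ω‖ ^ 4 + σ ^ 4
  cov_lipschitz : ∃ κ γ : ℝ, 0 ≤ κ ∧ 0 < γ ∧ γ ≤ 4 ∧
    ∀ (n : ℕ) (W : Ω → Stack N M), StronglyMeasurable[F n] W → MemLp W 4 P →
      ∀ᵐ ω ∂P, ‖Matrix.toEuclideanCLM (𝕜 := ℝ)
          (condCov P F J ghat n (fun _ => col wo) ω - condCov P F J ghat n W ω)‖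
        ≤ κ * ‖col wo - W ω‖ ^ γ
  cov_converges : ∃ R : Matrix (Fin N × Fin M) (Fin N × Fin M) ℝ, R.PosDef ∧
    ∀ᵐ ω ∂P, Tendsto (fun n => condCov P F J ghat n (fun _ => col wo) ω) atTop (𝓝 R)

end Noise

/-! ### The three recursions -/

/-- `μ_max`. -/
def stepMax {N : ℕ} (μ : Fin N → ℝ) : ℝ := ⨆ k, μ k

/-- `𝓐ᵀ = Aᵀ ⊗ I_M`. -/
def bigAT {N M : ℕ} (A : Matrix (Fin N) (Fin N) ℝ) : Stack N M →L[ℝ] Stack N M :=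
  { toFun := fun x => col fun k => ∑ l, A l k • x l
    map_add' := fun x y => by
      ext k : 1; simp only [col, PiLp.add_apply, smul_add, Finset.sum_add_distrib]
    map_smul' := fun c x => by
      ext k : 1; simp only [col, PiLp.smul_apply, Finset.smul_sum, smul_comm c, RingHom.id_apply]
    cont := (PiLp.continuous_toLp 2 _).comp (continuous_pi fun k =>
      continuous_finsetSum _ fun l _ => (PiLp.continuous_apply 2 _ l).const_smul (A l k)) }

/-- `𝓜 = diag{μ_1, …, μ_N} ⊗ I_M`. -/
def bigM {N M : ℕ} (μ : Fin N → ℝ) : Stack N M →L[ℝ] Stack N M :=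
  blockDiag fun k => μ k • ContinuousLinearMap.id ℝ (Param M)

/-- `𝓑 = 𝓐ᵀ (I - 𝓜 𝓗)` with `𝓗 = diag{∇²J_k(w_k^o)}`. -/
def bigB {N M : ℕ} (A : Matrix (Fin N) (Fin N) ℝ) (J : Fin N → Param M → ℝ)
    (wo : Fin N → Param M) (μ : Fin N → ℝ) : Stack N M →L[ℝ] Stack N M :=
  (bigAT A).comp (ContinuousLinearMap.id ℝ (Stack N M) - (bigM μ).comp (netHess J (col wo)))

/-- `H̄_m = ∑_{k ∈ 𝒢_m} (p_k μ_k / μ_max) ∇²J_k(w_k^o)`. -/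
def barH {N G M : ℕ} (J : Fin N → Param M → ℝ) (wo : Fin N → Param M) (group : Fin N → Fin G)
    (p μ : Fin N → ℝ) (m : Fin G) : Param M →L[ℝ] Param M :=
  ∑ k with group k = m, (p k * μ k / stepMax μ) • hess (J k) (wo k)

/-- `𝓓 = diag{D_1, …, D_G}` with `D_m = I - μ_max H̄_m`. -/
def bigD {N G M : ℕ} (J : Fin N → Param M → ℝ) (wo : Fin N → Param M) (group : Fin N → Fin G)
    (p μ : Fin N → ℝ) : Stack G M →L[ℝ] Stack G M :=
  blockDiag fun m => ContinuousLinearMap.id ℝ (Param M) - stepMax μ • barH J wo group p μ m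

/-- `𝓟ᵀ x`, where `𝓟 = diag{p_1, …, p_G} ⊗ I_M` has the Perron vectors of the groups as blocks. -/
def bigPT {N G M : ℕ} (group : Fin N → Fin G) (p : Fin N → ℝ) (x : Stack N M) : Stack G M :=
  col fun m => ∑ k with group k = m, p k • x k

/-- `col{1 ⊗ y_1, …, 1 ⊗ y_G}`: every agent gets the block of its group. -/
def lift {N G M : ℕ} (group : Fin N → Fin G) (y : Stack G M) : Stack N M :=
  col fun k => y (group k)

section Recursions

variable {Ω : Type*} {N G M : ℕ}

/-- The adapt-then-combine diffusion strategy
`ψ_k = w_k - μ_k ĝ_k(w_k)`, `w_k⁺ = ∑_l a_{lk} ψ_l`. -/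
def atc (ghat : ℕ → Ω → Fin N → Param M → Param M) (A : Matrix (Fin N) (Fin N) ℝ)
    (μ : Fin N → ℝ) (W₀ : Ω → Stack N M) : ℕ → Ω → Stack N M
  | 0, ω => W₀ ω
  | n + 1, ω => col fun k =>
      ∑ l, A l k • (atc ghat A μ W₀ n ω l - μ l • ghat n ω l (atc ghat A μ W₀ n ω l))

/-- The long-term model `X⁺ = 𝓑 X + 𝓐ᵀ 𝓜 𝒮(W)`, driven by the noise along the iterates `W`. -/
def longModel (J : Fin N → Param M → ℝ) (wo : Fin N → Param M)
    (ghat : ℕ → Ω → Fin N → Param M → Param M) (A : Matrix (Fin N) (Fin N) ℝ)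
    (μ : Fin N → ℝ) (W : ℕ → Ω → Stack N M) (X₀ : Ω → Stack N M) : ℕ → Ω → Stack N M
  | 0, ω => X₀ ω
  | n + 1, ω => bigB A J wo μ (longModel J wo ghat A μ W X₀ n ω)
      + bigAT A (bigM μ (noise J ghat n ω (W n ω)))

/-- The low-dimensional (centroid) model `Y⁺ = 𝓓 Y + 𝓟ᵀ 𝓜 𝒮(W)`. -/
def lowModel (J : Fin N → Param M → ℝ) (wo : Fin N → Param M)
    (ghat : ℕ → Ω → Fin N → Param M → Param M) (group : Fin N → Fin G) (p : Fin N → ℝ)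
    (μ : Fin N → ℝ) (W : ℕ → Ω → Stack N M) (Y₀ : Ω → Stack G M) : ℕ → Ω → Stack G M
  | 0, ω => Y₀ ω
  | n + 1, ω => bigD J wo group p μ (lowModel J wo ghat group p μ W Y₀ n ω)
      + bigPT group p (bigM μ (noise J ghat n ω (W n ω)))

end Recursions

end ClusterNet

end

/-!
Weight the blocks by the Perron vectors. In the norm `(∑_k p_k ‖x_k‖²)^{1/2}` the combination step
`𝓐ᵀ` is nonexpansive, and it loses exactly the variance of the combined blocks, which vanishes only
on stacked vectors that are constant on groups. On these the agents with strongly convex cost push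
a gradient step towards its target, so that by compactness a combination of any gradient-type step
contracts by a factor `1 - c μ_max`. This applies to `𝓑` and to the exact diffusion strategy alike.
Hence the mean square error of the iterates stays bounded and so does the variance of the
noise `𝒮_i`; since the noise is a martingale difference, its contributions of size `μ_max²` per step
add up to a mean square of order `μ_max` in the long-term model.

On vectors with vanishing weighted group means, `𝓐ᵀ` contracts by a factor `ρ < 1` that does not
depend on the step-sizes. The deviation of the long-term model from its group means is therefore
contracted by `ρ` and driven by terms of size `O(μ_max)`, so that it is `O(μ_max)` itself.

Finally, the centroid model is the long-term model with group means taken after every step. In the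
difference of the two models the noise has disappeared from the group means: these contract by
`1 - c μ_max` and are driven only by `O(μ_max)` times the deviation, i.e. by `O(μ_max²)`, which
makes them `O(μ_max)`.
-/

namespace ClusterNet

section Weights

variable {N M : ℕ}

/-- The operator `diag{√p_1, …, √p_N} ⊗ I_M`. For weights `p ≥ 0` it realises the weighted norm
`(∑_k p_k ‖x_k‖²)^{1/2}` as `‖sqrtWeight p x‖`, so that all estimates in the weighted norm can use
the inner product space `Stack N M`. -/
noncomputable def sqrtWeight (p : Fin N → ℝ) : Stack N M →L[ℝ] Stack N M := bigM fun k => √(p k)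

lemma bigAT_apply (A : Matrix (Fin N) (Fin N) ℝ) (x : Stack N M) (k : Fin N) :
    bigAT A x k = ∑ l, A l k • x l := rfl

lemma bigM_apply (μ : Fin N → ℝ) (x : Stack N M) (k : Fin N) : bigM μ x k = μ k • x k := rfl

lemma sqrtWeight_apply (p : Fin N → ℝ) (x : Stack N M) (k : Fin N) :
    sqrtWeight p x k = √(p k) • x k := rfl

variable {p : Fin N → ℝ}

lemma inner_sqrtWeight (hp : ∀ k, 0 ≤ p k) (x y : Stack N M) :
    inner ℝ (sqrtWeight p x) (sqrtWeight p y) = ∑ k, p k * inner ℝ (x k) (y k) := by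
  refine (PiLp.inner_apply _ _).trans (Finset.sum_congr rfl fun k _ => ?_)
  rw [sqrtWeight_apply, sqrtWeight_apply, real_inner_smul_left, real_inner_smul_right, ← mul_assoc,
    Real.mul_self_sqrt (hp k)]

lemma norm_sq_sqrtWeight (hp : ∀ k, 0 ≤ p k) (x : Stack N M) :
    ‖sqrtWeight p x‖ ^ 2 = ∑ k, p k * ‖x k‖ ^ 2 := by
  simp only [← real_inner_self_eq_norm_sq, inner_sqrtWeight hp]

lemma norm_le_of_forall_norm_le {c : ℝ} (hc : 0 ≤ c) {x y : Stack N M}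
    (h : ∀ k, ‖x k‖ ≤ c * ‖y k‖) : ‖x‖ ≤ c * ‖y‖ := by
  refine le_of_sq_le_sq ?_ (by positivity)
  rw [mul_pow, PiLp.norm_sq_eq_of_L2, PiLp.norm_sq_eq_of_L2, Finset.mul_sum]
  gcongr with k
  rw [← mul_pow]
  gcongr
  exact h k

lemma norm_sqrtWeight_le_of_forall_norm_le {c : ℝ} (hc : 0 ≤ c) {x y : Stack N M}
    (h : ∀ k, ‖x k‖ ≤ c * ‖y k‖) : ‖sqrtWeight p x‖ ≤ c * ‖sqrtWeight p y‖ := by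
  refine norm_le_of_forall_norm_le hc fun k => ?_
  rw [sqrtWeight_apply, sqrtWeight_apply, norm_smul, norm_smul, mul_left_comm]
  exact mul_le_mul_of_nonneg_left (h k) (norm_nonneg _)

lemma norm_sqrtWeight_bigM_le {μ : Fin N → ℝ} {m : ℝ} (hm : 0 ≤ m) (hμ : ∀ k, |μ k| ≤ m)
    (x : Stack N M) : ‖sqrtWeight p (bigM μ x)‖ ≤ m * ‖sqrtWeight p x‖ := by
  refine norm_sqrtWeight_le_of_forall_norm_le hm fun k => ?_
  rw [bigM_apply, norm_smul]
  exact mul_le_mul_of_nonneg_right (hμ k) (norm_nonneg _)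

lemma norm_sqrtWeight_le (hp : ∀ k, p k ≤ 1) (x : Stack N M) : ‖sqrtWeight p x‖ ≤ ‖x‖ := by
  rw [← one_mul ‖x‖]
  refine norm_le_of_forall_norm_le zero_le_one fun k => ?_
  rw [sqrtWeight_apply, norm_smul, Real.norm_of_nonneg (Real.sqrt_nonneg _)]
  exact mul_le_mul_of_nonneg_right (Real.sqrt_le_one.2 (hp k)) (norm_nonneg _)

lemma norm_le_mul_norm_sqrtWeight {q : ℝ} (hq : 0 < q) (hp : ∀ k, q ≤ p k) (x : Stack N M) :
    ‖x‖ ≤ (√q)⁻¹ * ‖sqrtWeight p x‖ := by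
  refine norm_le_of_forall_norm_le (by positivity) fun k => ?_
  rw [sqrtWeight_apply, norm_smul, Real.norm_of_nonneg (Real.sqrt_nonneg _), ← mul_assoc,
    inv_mul_eq_div]
  refine le_mul_of_one_le_left (norm_nonneg _) ?_
  exact (one_le_div (Real.sqrt_pos.2 hq)).2 (Real.sqrt_le_sqrt (hp k))

end Weights

section Averaging

variable {N M : ℕ} {A : Matrix (Fin N) (Fin N) ℝ} {p : Fin N → ℝ}

/-- A matrix of nonnegative combination weights with unit column sums that has `p` as a right
eigenvector, so that averaging with it is a contraction in the norm with weights `p`. -/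
structure IsAveraging (A : Matrix (Fin N) (Fin N) ℝ) (p : Fin N → ℝ) : Prop where
  nonneg : ∀ l k, 0 ≤ A l k
  col_sum : ∀ k, ∑ l, A l k = 1
  fix : A.mulVec p = p

lemma sum_mul_norm_sub_bigAT_sq (hA : ∀ k, ∑ l, A l k = 1) (x : Stack N M) (k : Fin N) :
    ∑ l, A l k * ‖x l - bigAT A x k‖ ^ 2 = ∑ l, A l k * ‖x l‖ ^ 2 - ‖bigAT A x k‖ ^ 2 := by
  have hterm (l : Fin N) : A l k * ‖x l - bigAT A x k‖ ^ 2 = A l k * ‖x l‖ ^ 2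
      - 2 * inner ℝ (A l k • x l) (bigAT A x k) + A l k * ‖bigAT A x k‖ ^ 2 := by
    rw [norm_sub_sq_real, real_inner_smul_left]; ring
  simp only [hterm, Finset.sum_add_distrib, Finset.sum_sub_distrib, ← Finset.mul_sum,
    ← Finset.sum_mul, hA, ← sum_inner, ← bigAT_apply, real_inner_self_eq_norm_sq]
  ring

lemma IsAveraging.norm_sq_sqrtWeight_bigAT (hA : IsAveraging A p) (hp : ∀ k, 0 ≤ p k)
    (x : Stack N M) :
    ‖sqrtWeight p (bigAT A x)‖ ^ 2 =
      ‖sqrtWeight p x‖ ^ 2 - ∑ k, p k * ∑ l, A l k * ‖x l - bigAT A x k‖ ^ 2 := by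
  have hmean : ∑ k, p k * ∑ l, A l k * ‖x l‖ ^ 2 = ∑ l, p l * ‖x l‖ ^ 2 := by
    simp only [Finset.mul_sum]
    rw [Finset.sum_comm]
    refine Finset.sum_congr rfl fun l _ => ?_
    rw [← congrFun hA.fix l, Matrix.mulVec, dotProduct, Finset.sum_mul]
    exact Finset.sum_congr rfl fun k _ => by ring
  simp only [norm_sq_sqrtWeight hp, sum_mul_norm_sub_bigAT_sq hA.col_sum, mul_sub,
    Finset.sum_sub_distrib, hmean, sub_sub_cancel]

lemma IsAveraging.norm_sqrtWeight_bigAT_le (hA : IsAveraging A p) (hp : ∀ k, 0 ≤ p k)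
    (x : Stack N M) : ‖sqrtWeight p (bigAT A x)‖ ≤ ‖sqrtWeight p x‖ := by
  refine le_of_sq_le_sq ?_ (norm_nonneg _)
  rw [hA.norm_sq_sqrtWeight_bigAT hp, sub_le_self_iff]
  exact Finset.sum_nonneg fun k _ => mul_nonneg (hp k) <|
    Finset.sum_nonneg fun l _ => mul_nonneg (hA.nonneg l k) (sq_nonneg _)

lemma IsAveraging.norm_sqrtWeight_bigAT_bigM_le (hA : IsAveraging A p) (hp : ∀ k, 0 ≤ p k)
    (hp' : ∀ k, p k ≤ 1) {μ : Fin N → ℝ} {m : ℝ} (hm : 0 ≤ m) (hμ : ∀ k, |μ k| ≤ m)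
    (x : Stack N M) : ‖sqrtWeight p (bigAT A (bigM μ x))‖ ≤ m * ‖x‖ :=
  calc ‖sqrtWeight p (bigAT A (bigM μ x))‖ ≤ ‖sqrtWeight p (bigM μ x)‖ :=
        hA.norm_sqrtWeight_bigAT_le hp _
    _ ≤ m * ‖sqrtWeight p x‖ := norm_sqrtWeight_bigM_le hm hμ x
    _ ≤ m * ‖x‖ := by gcongr; exact norm_sqrtWeight_le hp' x

lemma IsAveraging.eq_bigAT_of_norm_le (hA : IsAveraging A p) (hp : ∀ k, 0 < p k) {x : Stack N M}
    (hx : ‖sqrtWeight p x‖ ≤ ‖sqrtWeight p (bigAT A x)‖) {l k : Fin N} (hlk : 0 < A l k) :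
    x l = bigAT A x k := by
  have hinner (k : Fin N) : 0 ≤ ∑ l, A l k * ‖x l - bigAT A x k‖ ^ 2 :=
    Finset.sum_nonneg fun l _ => mul_nonneg (hA.nonneg l k) (sq_nonneg _)
  have hterm (k : Fin N) : 0 ≤ p k * ∑ l, A l k * ‖x l - bigAT A x k‖ ^ 2 :=
    mul_nonneg (hp k).le (hinner k)
  have hsum : ∑ k, p k * ∑ l, A l k * ‖x l - bigAT A x k‖ ^ 2 = 0 := by
    refine le_antisymm ?_ (Finset.sum_nonneg fun k _ => hterm k)
    have hvar := hA.norm_sq_sqrtWeight_bigAT (fun k => (hp k).le) x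
    have hsq : ‖sqrtWeight p x‖ ^ 2 ≤ ‖sqrtWeight p (bigAT A x)‖ ^ 2 := by gcongr
    linarith
  have hk := (Finset.sum_eq_zero_iff_of_nonneg fun k _ => hterm k).1 hsum k (Finset.mem_univ k)
  have hl := (Finset.sum_eq_zero_iff_of_nonneg fun l _ =>
    mul_nonneg (hA.nonneg l k) (sq_nonneg ‖x l - bigAT A x k‖)).1
    ((mul_eq_zero.1 hk).resolve_left (hp k).ne') l (Finset.mem_univ l)
  simpa [hlk.ne', sub_eq_zero] using hl

lemma bigAT_eq_self_of_sum_eq_one (hA : ∀ k, ∑ l, A l k = 1) {x : Stack N M}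
    (hx : ∀ l k, A l k ≠ 0 → x l = x k) : bigAT A x = x := by
  ext k : 1
  have hterm (l : Fin N) : A l k • x l = A l k • x k := by
    by_cases h : A l k = 0
    · rw [h, zero_smul, zero_smul]
    · rw [hx l k h]
  simp only [bigAT_apply, hterm, ← Finset.sum_smul, hA, one_smul]

lemma bigAT_bigAT (A B : Matrix (Fin N) (Fin N) ℝ) (x : Stack N M) :
    bigAT A (bigAT B x) = bigAT (B * A) x := by
  ext k : 1
  simp only [bigAT_apply, Matrix.mul_apply, Finset.smul_sum, Finset.sum_smul, smul_smul,
    mul_comm (A _ k)]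
  exact Finset.sum_comm

end Averaging

section Combination

variable {N G M : ℕ} {Gr : SimpleGraph (Fin N)} {group : Fin N → Fin G}
  {A : Matrix (Fin N) (Fin N) ℝ} {p : Fin N → ℝ}

lemma IsCombinationMatrix.nonneg (hA : IsCombinationMatrix Gr group A) (l k : Fin N) :
    0 ≤ A l k := by
  by_cases h : group l = group k ∧ (l = k ∨ Gr.Adj l k)
  · exact (hA.pos l k h.1 h.2).le
  · exact (hA.zero l k h).ge

lemma IsCombinationMatrix.group_eq_of_ne_zero (hA : IsCombinationMatrix Gr group A) {l k : Fin N}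
    (h : A l k ≠ 0) : group l = group k :=
  (not_not.1 (mt (hA.zero l k) h)).1

lemma IsPerronVector.mulVec_eq (hA : IsCombinationMatrix Gr group A)
    (hp : IsPerronVector group A p) : A.mulVec p = p := by
  ext k
  rw [← hp.eigen k, Finset.sum_filter, Matrix.mulVec, dotProduct]
  refine Finset.sum_congr rfl fun l (_ : l ∈ Finset.univ) => ?_
  split_ifs with h
  · rfl
  · rw [not_not.1 (mt hA.group_eq_of_ne_zero fun hkl => h hkl.symm), zero_mul]

lemma forall_group_of_adj (hconn : ∀ m, (Gr.induce {k | group k = m}).Connected)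
    {S : Fin N → Prop} (hS : ∀ k l, group k = group l → Gr.Adj k l → S k → S l)
    {k l : Fin N} (hkl : group k = group l) (hk : S k) : S l := by
  suffices hreach : ∀ b : {j | group j = group l},
      Relation.ReflTransGen (Gr.induce {j | group j = group l}).Adj ⟨k, hkl⟩ b → S b from
    hreach ⟨l, rfl⟩ ((SimpleGraph.reachable_iff_reflTransGen _ _).1
      ((hconn (group l)).preconnected _ _))
  intro b hb
  induction hb with
  | refl => exact hk
  | @tail b c _ hbc hb => exact hS b c (b.2.trans c.2.symm) hbc hb

lemma IsCombinationMatrix.eq_zero_of_mulVec_eq (hA : IsCombinationMatrix Gr group A)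
    (hconn : ∀ m, (Gr.induce {k | group k = m}).Connected) {q : Fin N → ℝ} (hq : ∀ k, 0 ≤ q k)
    (hfix : A.mulVec q = q) {k l : Fin N} (hkl : group k = group l) (hk : q k = 0) : q l = 0 := by
  refine forall_group_of_adj (S := fun k => q k = 0) hconn (fun a b hab hadj ha => ?_) hkl hk
  have hsum : ∑ l, A a l * q l = 0 := (congrFun hfix a).trans ha
  rw [Finset.sum_eq_zero_iff_of_nonneg fun l _ => mul_nonneg (hA.nonneg a l) (hq l)] at hsum
  exact (mul_eq_zero.1 (hsum b (Finset.mem_univ b))).resolve_left (hA.pos a b hab (.inr hadj)).ne'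

lemma IsCombinationMatrix.mulVec_abs_eq (hA : IsCombinationMatrix Gr group A) {q : Fin N → ℝ}
    (hfix : A.mulVec q = q) : A.mulVec |q| = |q| := by
  have hle (k : Fin N) : |q k| ≤ A.mulVec |q| k := by
    conv_lhs => rw [← congrFun hfix k, Matrix.mulVec, dotProduct]
    refine (Finset.abs_sum_le_sum_abs _ _).trans (Finset.sum_le_sum fun l _ => ?_)
    rw [abs_mul, abs_of_nonneg (hA.nonneg k l), Pi.abs_apply]
  have hsum : ∑ k, |q k| = ∑ k, A.mulVec |q| k := by
    simp only [Matrix.mulVec, dotProduct]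
    rw [Finset.sum_comm]
    refine Finset.sum_congr rfl fun l _ => ?_
    rw [← Finset.sum_mul, hA.col_sum, one_mul, Pi.abs_apply]
  ext k
  exact ((Finset.sum_eq_sum_iff_of_le fun k _ => hle k).1 hsum k (Finset.mem_univ k)).symm

lemma IsPerronVector.nonneg (hA : IsCombinationMatrix Gr group A) (hp : IsPerronVector group A p)
    (hconn : ∀ m, (Gr.induce {k | group k = m}).Connected) (k : Fin N) : 0 ≤ p k := by
  by_contra! hk
  have hfix := hp.mulVec_eq hA
  -- `|p| - p` is a nonnegative fixed vector: if it vanished somewhere on the group, then `p k ≥ 0`.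
  have hneg (l : Fin N) (hl : group l = group k) : p l ≤ 0 := by
    by_contra! hl'
    have hzero : (|p| - p) k = 0 := hA.eq_zero_of_mulVec_eq hconn (q := |p| - p)
      (fun j => sub_nonneg.2 (le_abs_self (p j)))
      (by rw [Matrix.mulVec_sub, hA.mulVec_abs_eq hfix, hfix]) hl
      (sub_eq_zero.2 (abs_of_pos hl'))
    rw [Pi.sub_apply, Pi.abs_apply, abs_of_neg hk] at hzero
    linarith
  have hsum : ∑ l with group l = group k, p l ≤ 0 :=
    Finset.sum_nonpos fun l hl => hneg l (Finset.mem_filter.1 hl).2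
  linarith [hp.sum_one (group k)]

lemma IsPerronVector.pos (hA : IsCombinationMatrix Gr group A) (hp : IsPerronVector group A p)
    (hconn : ∀ m, (Gr.induce {k | group k = m}).Connected) (k : Fin N) : 0 < p k := by
  have hnonneg := hp.nonneg hA hconn
  refine (hnonneg k).lt_of_ne' fun hk => one_ne_zero (α := ℝ) ?_
  rw [← hp.sum_one (group k)]
  exact Finset.sum_eq_zero fun l hl => hA.eq_zero_of_mulVec_eq hconn hnonneg (hp.mulVec_eq hA)
    (Finset.mem_filter.1 hl).2.symm hk

lemma IsPerronVector.le_one (hp : IsPerronVector group A p) (hpos : ∀ k, 0 ≤ p k) (k : Fin N) :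
    p k ≤ 1 := by
  rw [← hp.sum_one (group k)]
  exact Finset.single_le_sum (f := p) (fun l _ => hpos l) (by simp)

lemma IsCombinationMatrix.isAveraging (hA : IsCombinationMatrix Gr group A)
    (hp : IsPerronVector group A p) : IsAveraging A p :=
  ⟨hA.nonneg, hA.col_sum, hp.mulVec_eq hA⟩

lemma IsCombinationMatrix.eq_of_norm_le (hA : IsCombinationMatrix Gr group A)
    (hp : IsPerronVector group A p) (hconn : ∀ m, (Gr.induce {k | group k = m}).Connected)
    {x : Stack N M} (hx : ‖sqrtWeight p x‖ ≤ ‖sqrtWeight p (bigAT A x)‖) {k l : Fin N}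
    (hkl : group k = group l) : x k = x l := by
  have hmean {l k : Fin N} (hlk : 0 < A l k) : x l = bigAT A x k :=
    (hA.isAveraging hp).eq_bigAT_of_norm_le (hp.pos hA hconn) hx hlk
  refine forall_group_of_adj (S := fun l => x k = x l) hconn (fun a b hab hadj ha => ?_) hkl rfl
  exact ha.trans ((hmean (hA.pos a b hab (.inr hadj))).trans
    (hmean (hA.pos b b rfl (.inl rfl))).symm)

/-- The matrix `𝓟 𝓛ᵀ` (up to the factor `I_M`), where `𝓟` has the Perron vectors and `𝓛` the
indicators of the groups as columns: averaging with it replaces every block by the weighted mean of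
its group. -/
def meanMatrix (group : Fin N → Fin G) (p : Fin N → ℝ) : Matrix (Fin N) (Fin N) ℝ :=
  Matrix.of fun l k => if group l = group k then p l else 0

/-- The projection of a stacked vector onto its weighted group means. -/
def groupMean (group : Fin N → Fin G) (p : Fin N → ℝ) : Stack N M →L[ℝ] Stack N M :=
  bigAT (meanMatrix group p)

lemma lift_bigPT (x : Stack N M) : lift group (bigPT group p x) = groupMean group p x := by
  ext k : 1
  simp only [lift, bigPT, col, groupMean, bigAT_apply, meanMatrix, Matrix.of_apply, ite_smul,
    zero_smul, ← Finset.sum_filter]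

lemma IsPerronVector.meanMatrix_col_sum (hp : IsPerronVector group A p) (k : Fin N) :
    ∑ l, meanMatrix group p l k = 1 := by
  simp only [meanMatrix, Matrix.of_apply, ← Finset.sum_filter, hp.sum_one]

lemma IsPerronVector.isAveraging_meanMatrix (hp : IsPerronVector group A p)
    (hnonneg : ∀ k, 0 ≤ p k) : IsAveraging (meanMatrix group p) p where
  nonneg l k := by
    simp only [meanMatrix, Matrix.of_apply]
    split_ifs
    exacts [hnonneg l, le_rfl]
  col_sum := hp.meanMatrix_col_sum
  fix := by
    ext l
    simp only [Matrix.mulVec, dotProduct, meanMatrix, Matrix.of_apply, ite_mul, zero_mul,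
      ← Finset.sum_filter, ← Finset.mul_sum, eq_comm (a := group l), hp.sum_one, mul_one]

lemma IsPerronVector.groupMean_eq_self (hp : IsPerronVector group A p)
    {x : Stack N M} (hx : ∀ k l, group k = group l → x k = x l) : groupMean group p x = x :=
  bigAT_eq_self_of_sum_eq_one hp.meanMatrix_col_sum fun l k hlk =>
    hx l k (not_not.1 fun h => hlk (if_neg h))

lemma groupMean_apply_eq_of_group_eq (x : Stack N M) {k l : Fin N} (hkl : group k = group l) :
    groupMean group p x k = groupMean group p x l := by
  simp only [← lift_bigPT, lift, col, hkl]

lemma IsPerronVector.groupMean_lift (hp : IsPerronVector group A p)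
    (y : Stack G M) : groupMean group p (lift group y) = lift group y :=
  hp.groupMean_eq_self fun k l hkl => by simp only [lift, col, hkl]

lemma IsPerronVector.groupMean_groupMean (hp : IsPerronVector group A p)
    (x : Stack N M) : groupMean group p (groupMean group p x) = groupMean group p x :=
  hp.groupMean_eq_self fun _ _ => groupMean_apply_eq_of_group_eq x

lemma IsCombinationMatrix.bigAT_eq_self (hA : IsCombinationMatrix Gr group A)
    {x : Stack N M} (hx : ∀ k l, group k = group l → x k = x l) : bigAT A x = x :=
  bigAT_eq_self_of_sum_eq_one hA.col_sum fun l k hlk => hx l k (hA.group_eq_of_ne_zero hlk)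

lemma IsCombinationMatrix.bigAT_groupMean (hA : IsCombinationMatrix Gr group A) (x : Stack N M) :
    bigAT A (groupMean group p x) = groupMean group p x :=
  hA.bigAT_eq_self fun _ _ => groupMean_apply_eq_of_group_eq x

lemma IsCombinationMatrix.groupMean_bigAT (hA : IsCombinationMatrix Gr group A)
    (hp : IsPerronVector group A p) (x : Stack N M) :
    groupMean group p (bigAT A x) = groupMean group p x := by
  rw [groupMean, bigAT_bigAT]
  congr 2
  ext j k
  have hterm (l : Fin N) : A j l * meanMatrix group p l k
      = if group j = group k then A j l * p l else 0 := by
    by_cases h : A j l = 0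
    · simp [h]
    · simp [meanMatrix, hA.group_eq_of_ne_zero h]
  simp only [Matrix.mul_apply, hterm]
  split_ifs with h
  · rw [meanMatrix, Matrix.of_apply, if_pos h]
    exact congrFun (hp.mulVec_eq hA) j
  · simp [meanMatrix, h]

end Combination

section Contraction

variable {N G M : ℕ} {Gr : SimpleGraph (Fin N)} {group : Fin N → Fin G}
  {A : Matrix (Fin N) (Fin N) ℝ} {p : Fin N → ℝ}

lemma exists_pos_mul_norm_sq_le {E : Type*} [NormedAddCommGroup E] [NormedSpace ℝ E]
    [ProperSpace E] {q : E → ℝ} (hq : Continuous q) (hhom : ∀ (c : ℝ) x, q (c • x) = c ^ 2 * q x)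
    (hpos : ∀ x, x ≠ 0 → 0 < q x) : ∃ c, 0 < c ∧ ∀ x, c * ‖x‖ ^ 2 ≤ q x := by
  rcases subsingleton_or_nontrivial E with hE | hE
  · refine ⟨1, one_pos, fun x => ?_⟩
    rw [Subsingleton.elim x 0]
    simpa using (hhom 0 0).ge
  obtain ⟨y, hy, hmin⟩ := (isCompact_sphere (0 : E) 1).exists_isMinOn
    (NormedSpace.sphere_nonempty.2 zero_le_one) hq.continuousOn
  refine ⟨q y, hpos y (ne_zero_of_mem_unit_sphere ⟨y, hy⟩), fun x => ?_⟩
  rcases eq_or_ne x 0 with rfl | hx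
  · simpa using (hhom 0 0).ge
  have hunit : q y ≤ q (‖x‖⁻¹ • x) := hmin (by simp [norm_smul, hx])
  have hx' : 0 < ‖x‖ ^ 2 := by positivity
  rwa [hhom, inv_pow, inv_mul_eq_div, le_div_iff₀ hx'] at hunit

lemma exists_pos_mul_norm_sq_le_defect_add (hA : IsCombinationMatrix Gr group A)
    (hp : IsPerronVector group A p) (hconn : ∀ m, (Gr.induce {k | group k = m}).Connected)
    {r : Stack N M → ℝ} (hr : Continuous r) (hhom : ∀ (c : ℝ) x, r (c • x) = c ^ 2 * r x)
    (hnonneg : ∀ x, 0 ≤ r x)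
    (hpos : ∀ x, (∀ k l, group k = group l → x k = x l) → x ≠ 0 → 0 < r x) :
    ∃ c, 0 < c ∧ ∀ x, c * ‖sqrtWeight p x‖ ^ 2
      ≤ ‖sqrtWeight p x‖ ^ 2 - ‖sqrtWeight p (bigAT A x)‖ ^ 2 + r x := by
  have hp0 := hp.nonneg hA hconn
  have hle (x : Stack N M) : ‖sqrtWeight p (bigAT A x)‖ ≤ ‖sqrtWeight p x‖ :=
    (hA.isAveraging hp).norm_sqrtWeight_bigAT_le hp0 x
  have hdefect (x : Stack N M) :
      0 ≤ ‖sqrtWeight p x‖ ^ 2 - ‖sqrtWeight p (bigAT A x)‖ ^ 2 :=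
    sub_nonneg.2 (pow_le_pow_left₀ (norm_nonneg _) (hle x) 2)
  obtain ⟨c, hc, hbound⟩ := exists_pos_mul_norm_sq_le
    (q := fun x => ‖sqrtWeight p x‖ ^ 2 - ‖sqrtWeight p (bigAT A x)‖ ^ 2 + r x) (by fun_prop)
    (fun c x => by
      simp only [map_smul, norm_smul, mul_pow, Real.norm_eq_abs, sq_abs, hhom]; ring)
    (fun x hx => by
      refine (add_nonneg (hdefect x) (hnonneg x)).lt_of_ne' fun hzero => ?_
      have hr0 : r x = 0 := by linarith [hdefect x, hnonneg x]
      have hnorm : ‖sqrtWeight p x‖ ≤ ‖sqrtWeight p (bigAT A x)‖ :=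
        le_of_sq_le_sq (by linarith) (norm_nonneg _)
      exact (hpos x (fun k l => hA.eq_of_norm_le hp hconn hnorm) hx).ne' hr0)
  refine ⟨c, hc, fun x => le_trans ?_ (hbound x)⟩
  gcongr
  exact norm_sqrtWeight_le (hp.le_one hp0) x

lemma exists_lt_one_norm_sqrtWeight_bigAT_le (hA : IsCombinationMatrix Gr group A)
    (hp : IsPerronVector group A p) (hconn : ∀ m, (Gr.induce {k | group k = m}).Connected)
    (M : ℕ) :
    ∃ ρ : ℝ, 0 ≤ ρ ∧ ρ < 1 ∧ ∀ x : Stack N M, groupMean group p x = 0 →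
      ‖sqrtWeight p (bigAT A x)‖ ≤ ρ * ‖sqrtWeight p x‖ := by
  obtain ⟨c, hc, hbound⟩ := exists_pos_mul_norm_sq_le_defect_add (M := M) hA hp hconn
    (r := fun x => ‖groupMean group p x‖ ^ 2) (by fun_prop)
    (fun c x => by simp only [map_smul, norm_smul, mul_pow, Real.norm_eq_abs, sq_abs])
    (fun x => sq_nonneg _)
    (fun x hx hx0 => by
      rw [hp.groupMean_eq_self hx]
      positivity)
  refine ⟨√(1 - c), Real.sqrt_nonneg _, (Real.sqrt_lt' one_pos).2 (by linarith), fun x hx => ?_⟩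
  have hsq := hbound x
  rw [hx, norm_zero, zero_pow two_ne_zero, add_zero] at hsq
  rw [← Real.sqrt_sq (norm_nonneg (sqrtWeight p x)), ← Real.sqrt_mul' _ (sq_nonneg _)]
  exact Real.le_sqrt_of_sq_le (by linarith)

lemma norm_map_sub_sq_le {E F : Type*} [NormedAddCommGroup E] [NormedSpace ℝ E]
    [NormedAddCommGroup F] [InnerProductSpace ℝ F] {D D' : E →L[ℝ] F} (h : ∀ x, ‖D' x‖ ≤ ‖D x‖)
    (x y : E) :
    ‖D' (x - y)‖ ^ 2 ≤ (‖D x‖ ^ 2 + ‖D' x‖ ^ 2) / 2 - 2 * inner ℝ (D x) (D y) + 2 * ‖D y‖ ^ 2 := by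
  -- The defect `‖D x‖² - ‖D' x‖²` is a nonnegative quadratic form, so that its value at `x` is at
  -- most twice the sum of its values at `x - y` and at `y`.
  have hdefect := pow_le_pow_left₀ (norm_nonneg _) (h (x - y - y)) 2
  have hpar := parallelogram_law_with_norm ℝ (D (x - y)) (D y)
  have hpar' := parallelogram_law_with_norm ℝ (D' (x - y)) (D' y)
  have hexpand := norm_sub_sq_real (D x) (D y)
  simp only [← map_add, ← map_sub, sub_add_cancel] at hpar hpar' hexpand
  nlinarith [sq_nonneg ‖D' y‖]

/-- Blockwise sector condition: every `g_k` relates to `x_k` like the image of `x_k` under a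
symmetric matrix between `λ_k I` and `L I`. Both Hessians and gradient increments satisfy it. -/
def SectorBound (lam : Fin N → ℝ) (L : ℝ) (x g : Stack N M) : Prop :=
  ∀ k, lam k * ‖x k‖ ^ 2 ≤ inner ℝ (x k) (g k) ∧ ‖g k‖ ≤ L * ‖x k‖

/-- One combination of a gradient-type step of sizes `μ`, with any direction satisfying the sector
condition, contracts the norm with weights `p` by the factor `r`. -/
def IsSectorContraction (M : ℕ) (A : Matrix (Fin N) (Fin N) ℝ) (p lam : Fin N → ℝ) (L : ℝ)
    (μ : Fin N → ℝ) (r : ℝ) : Prop :=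
  ∀ x g : Stack N M, SectorBound lam L x g →
    ‖sqrtWeight p (bigAT A (x - bigM μ g))‖ ≤ r * ‖sqrtWeight p x‖

lemma norm_sq_sqrtWeight_bigAT_sub_bigM_le (hA : IsAveraging A p) (hp : ∀ k, 0 ≤ p k)
    {lam : Fin N → ℝ} (hlam : ∀ k, 0 ≤ lam k) {L : ℝ} (hL : 0 ≤ L) {μ : Fin N → ℝ} {s m : ℝ}
    (hs : 0 ≤ s) (hμ : ∀ k, μ k ∈ Set.Icc s m) {x g : Stack N M} (hg : SectorBound lam L x g)
    (hm : 0 ≤ m) :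
    ‖sqrtWeight p (bigAT A (x - bigM μ g))‖ ^ 2
      ≤ (‖sqrtWeight p x‖ ^ 2 + ‖sqrtWeight p (bigAT A x)‖ ^ 2) / 2
        - 2 * s * ∑ k, p k * (lam k * ‖x k‖ ^ 2) + 2 * (m * L) ^ 2 * ‖sqrtWeight p x‖ ^ 2 := by
  have hstep : ‖sqrtWeight p (bigM μ g)‖ ≤ m * L * ‖sqrtWeight p x‖ := by
    rw [mul_assoc]
    refine (norm_sqrtWeight_bigM_le hm
      (fun k => (abs_of_nonneg (hs.trans (hμ k).1)).trans_le (hμ k).2) g).trans ?_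
    gcongr
    exact norm_sqrtWeight_le_of_forall_norm_le hL fun k => (hg k).2
  have hinner : s * ∑ k, p k * (lam k * ‖x k‖ ^ 2)
      ≤ inner ℝ (sqrtWeight p x) (sqrtWeight p (bigM μ g)) := by
    rw [inner_sqrtWeight hp, Finset.mul_sum]
    refine Finset.sum_le_sum fun k _ => ?_
    rw [bigM_apply, real_inner_smul_right, mul_left_comm]
    have hlamx : 0 ≤ lam k * ‖x k‖ ^ 2 := mul_nonneg (hlam k) (sq_nonneg _)
    exact mul_le_mul_of_nonneg_left (mul_le_mul (hμ k).1 (hg k).1 hlamx (hs.trans (hμ k).1)) (hp k)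
  have hmain := norm_map_sub_sq_le (D := sqrtWeight p) (D' := (sqrtWeight p).comp (bigAT A))
    (fun x => hA.norm_sqrtWeight_bigAT_le hp x) x (bigM μ g)
  have hsq := pow_le_pow_left₀ (norm_nonneg _) hstep 2
  rw [mul_pow] at hsq
  simp only [ContinuousLinearMap.comp_apply] at hmain
  linarith

lemma exists_pos_mul_norm_sq_le_defect_add_sum (hA : IsCombinationMatrix Gr group A)
    (hp : IsPerronVector group A p) (hconn : ∀ m, (Gr.induce {k | group k = m}).Connected) (M : ℕ)
    {lam : Fin N → ℝ} (hlam : ∀ k, 0 ≤ lam k) (hlam' : ∀ m, ∃ k, group k = m ∧ 0 < lam k) :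
    ∃ c, 0 < c ∧ ∀ x : Stack N M, c * ‖sqrtWeight p x‖ ^ 2
      ≤ ‖sqrtWeight p x‖ ^ 2 - ‖sqrtWeight p (bigAT A x)‖ ^ 2
        + ∑ k, p k * (lam k * ‖x k‖ ^ 2) := by
  have hterm (x : Stack N M) (k : Fin N) : 0 ≤ p k * (lam k * ‖x k‖ ^ 2) :=
    mul_nonneg (hp.nonneg hA hconn k) (mul_nonneg (hlam k) (sq_nonneg _))
  refine exists_pos_mul_norm_sq_le_defect_add hA hp hconn (by fun_prop) (fun c x => ?_)
    (fun x => Finset.sum_nonneg fun k _ => hterm x k) fun x hconst hx => ?_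
  · simp only [PiLp.smul_apply, norm_smul, mul_pow, Real.norm_eq_abs, sq_abs, Finset.mul_sum]
    exact Finset.sum_congr rfl fun k _ => by ring
  · obtain ⟨k, hk⟩ : ∃ k, x k ≠ 0 := by
      by_contra! hzero
      exact hx (by ext k : 1; exact hzero k)
    obtain ⟨l, hl, hlaml⟩ := hlam' (group k)
    refine Finset.sum_pos' (fun k _ => hterm x k)
      ⟨l, Finset.mem_univ l, mul_pos (hp.pos hA hconn l) (mul_pos hlaml ?_)⟩
    rw [hconst l k hl]
    positivity

lemma eventually_mul_le_nhdsGT_zero (a : ℝ) {b : ℝ} (hb : 0 < b) :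
    ∀ᶠ m in 𝓝[>] (0 : ℝ), a * m ≤ b := by
  have hlim : Tendsto (fun m : ℝ => a * m) (𝓝 0) (𝓝 0) := by
    simpa using (continuous_const_mul a).tendsto 0
  exact nhdsWithin_le_nhds (hlim.eventually_le_const hb)

lemma exists_eventually_isSectorContraction (hA : IsCombinationMatrix Gr group A)
    (hp : IsPerronVector group A p) (hconn : ∀ m, (Gr.induce {k | group k = m}).Connected)
    (M : ℕ) {lam : Fin N → ℝ} (hlam : ∀ k, 0 ≤ lam k)
    (hlam' : ∀ m, ∃ k, group k = m ∧ 0 < lam k) {L : ℝ} (hL : 0 ≤ L)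
    {τ : ℝ} (hτ : 0 < τ) :
    ∃ c : ℝ, 0 < c ∧ ∀ᶠ m in 𝓝[>] (0 : ℝ), c * m ≤ 1 ∧
      ∀ μ : Fin N → ℝ, (∀ k, μ k ∈ Set.Icc (τ * m) m) →
        IsSectorContraction M A p lam L μ (1 - c * m) := by
  have hp0 := hp.nonneg hA hconn
  have hAv := hA.isAveraging hp
  obtain ⟨c₀, hc₀, hcoercive⟩ := exists_pos_mul_norm_sq_le_defect_add_sum hA hp hconn M hlam hlam'
  obtain ⟨κ, hκ, hκ2, hκτ⟩ : ∃ κ : ℝ, 0 < κ ∧ κ ≤ 1 / 2 ∧ κ ≤ 2 * τ :=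
    ⟨min (1 / 2) (2 * τ), by positivity, min_le_left _ _, min_le_right _ _⟩
  refine ⟨κ * c₀ / 4, by positivity, ?_⟩
  filter_upwards [self_mem_nhdsWithin, eventually_mul_le_nhdsGT_zero 1 one_pos,
    eventually_mul_le_nhdsGT_zero (κ * c₀ / 4) one_pos,
    eventually_mul_le_nhdsGT_zero (4 * L ^ 2) (mul_pos hκ hc₀)] with m hm hm1 hcm hLm
  have hm0 : 0 < m := hm
  refine ⟨hcm, fun μ hμ x g hg => le_of_sq_le_sq ?_
    (mul_nonneg (sub_nonneg.2 hcm) (norm_nonneg _))⟩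
  have hstep := norm_sq_sqrtWeight_bigAT_sub_bigM_le hAv hp0 hlam hL (by positivity) hμ hg hm0.le
  have hdefect := pow_le_pow_left₀ (norm_nonneg _) (hAv.norm_sqrtWeight_bigAT_le hp0 x) 2
  have hsum : 0 ≤ ∑ k, p k * (lam k * ‖x k‖ ^ 2) :=
    Finset.sum_nonneg fun k _ => mul_nonneg (hp0 k) (mul_nonneg (hlam k) (sq_nonneg _))
  have hgain : κ * m * (c₀ * ‖sqrtWeight p x‖ ^ 2)
      ≤ (‖sqrtWeight p x‖ ^ 2 - ‖sqrtWeight p (bigAT A x)‖ ^ 2) / 2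
        + 2 * (τ * m) * ∑ k, p k * (lam k * ‖x k‖ ^ 2) := by
    refine (mul_le_mul_of_nonneg_left (hcoercive x) (by positivity)).trans ?_
    have hκm : κ * m ≤ 1 / 2 := by nlinarith
    have hκτm : κ * m ≤ 2 * (τ * m) := by nlinarith
    rw [mul_add]
    refine add_le_add ?_ (mul_le_mul_of_nonneg_right hκτm hsum)
    nlinarith
  have hloss : 2 * (m * L) ^ 2 * ‖sqrtWeight p x‖ ^ 2
      ≤ κ * m * (c₀ * ‖sqrtWeight p x‖ ^ 2) / 2 := by
    have := mul_le_mul_of_nonneg_right hLm (by positivity : 0 ≤ m * ‖sqrtWeight p x‖ ^ 2)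
    linarith
  nlinarith [sq_nonneg (κ * c₀ / 4 * m * ‖sqrtWeight p x‖)]

end Contraction

section Deviation

variable {N G M : ℕ} {Gr : SimpleGraph (Fin N)} {group : Fin N → Fin G}
  {A : Matrix (Fin N) (Fin N) ℝ} {p : Fin N → ℝ}

/-- The deviation of a stacked vector from its weighted group means. -/
def groupDeviation (group : Fin N → Fin G) (p : Fin N → ℝ) : Stack N M →L[ℝ] Stack N M :=
  ContinuousLinearMap.id ℝ (Stack N M) - groupMean group p

lemma groupMean_add_groupDeviation (x : Stack N M) :
    groupMean group p x + groupDeviation group p x = x :=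
  add_sub_cancel _ _

lemma IsPerronVector.norm_sqrtWeight_groupMean_le (hp : IsPerronVector group A p)
    (hnonneg : ∀ k, 0 ≤ p k) (x : Stack N M) :
    ‖sqrtWeight p (groupMean group p x)‖ ≤ ‖sqrtWeight p x‖ :=
  (hp.isAveraging_meanMatrix hnonneg).norm_sqrtWeight_bigAT_le hnonneg x

lemma IsPerronVector.norm_sqrtWeight_groupDeviation_le (hp : IsPerronVector group A p)
    (hnonneg : ∀ k, 0 ≤ p k) (x : Stack N M) :
    ‖sqrtWeight p (groupDeviation group p x)‖ ≤ 2 * ‖sqrtWeight p x‖ := by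
  have hmean := hp.norm_sqrtWeight_groupMean_le hnonneg x
  have htri := norm_sub_le (sqrtWeight p x) (sqrtWeight p (groupMean group p x))
  rw [← map_sub] at htri
  exact htri.trans (by linarith)

lemma IsPerronVector.groupMean_groupDeviation (hp : IsPerronVector group A p) (x : Stack N M) :
    groupMean group p (groupDeviation group p x) = 0 :=
  (map_sub _ _ _).trans (sub_eq_zero.2 (hp.groupMean_groupMean x).symm)

lemma IsPerronVector.groupDeviation_lift (hp : IsPerronVector group A p) (y : Stack G M) :
    groupDeviation group p (lift group y) = 0 :=
  sub_eq_zero.2 (hp.groupMean_lift y).symm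

lemma IsCombinationMatrix.groupDeviation_bigAT (hA : IsCombinationMatrix Gr group A)
    (hp : IsPerronVector group A p) (x : Stack N M) :
    groupDeviation group p (bigAT A x) = bigAT A (groupDeviation group p x) := by
  simp only [groupDeviation, sub_apply, ContinuousLinearMap.id_apply, map_sub,
    hA.groupMean_bigAT hp, hA.bigAT_groupMean]

lemma norm_sqrtWeight_groupDeviation_bigAT_add_le (hA : IsCombinationMatrix Gr group A)
    (hp : IsPerronVector group A p) (hnonneg : ∀ k, 0 ≤ p k) {ρ : ℝ}
    (hρ : ∀ x : Stack N M, groupMean group p x = 0 →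
      ‖sqrtWeight p (bigAT A x)‖ ≤ ρ * ‖sqrtWeight p x‖) (x y : Stack N M) :
    ‖sqrtWeight p (groupDeviation group p (bigAT A (x + y)))‖
      ≤ ρ * ‖sqrtWeight p (groupDeviation group p x)‖ + 2 * ‖sqrtWeight p y‖ := by
  rw [map_add, map_add, map_add]
  refine (norm_add_le _ _).trans (add_le_add ?_ ?_)
  · rw [hA.groupDeviation_bigAT hp]
    exact hρ _ (hp.groupMean_groupDeviation x)
  · refine (hp.norm_sqrtWeight_groupDeviation_le hnonneg _).trans ?_
    gcongr
    exact (hA.isAveraging hp).norm_sqrtWeight_bigAT_le hnonneg y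

lemma norm_sqrtWeight_groupMean_bigAT_sub_le (hA : IsCombinationMatrix Gr group A)
    (hp : IsPerronVector group A p) (hnonneg : ∀ k, 0 ≤ p k) {T : Stack N M →L[ℝ] Stack N M}
    {r b : ℝ} (hr : ∀ x, ‖sqrtWeight p (bigAT A (x - T x))‖ ≤ r * ‖sqrtWeight p x‖)
    (hb : ∀ x, ‖sqrtWeight p (T x)‖ ≤ b * ‖sqrtWeight p x‖) (z : Stack N M) :
    ‖sqrtWeight p (groupMean group p (bigAT A (z - T z)))‖
      ≤ r * ‖sqrtWeight p (groupMean group p z)‖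
        + b * ‖sqrtWeight p (groupDeviation group p z)‖ := by
  set u := groupMean group p z
  set v := groupDeviation group p z
  have hsplit : groupMean group p (bigAT A (z - T z))
      = groupMean group p (bigAT A (u - T u)) - groupMean group p (T v) := by
    have hz : z - T z = (u - T u) + (v - T v) := by
      rw [← add_sub_add_comm, ← map_add, groupMean_add_groupDeviation]
    rw [hz, map_add, map_add, hA.groupMean_bigAT hp (v - T v), map_sub (groupMean group p) v,
      hp.groupMean_groupDeviation, zero_sub, ← sub_eq_add_neg]
  rw [hsplit, map_sub]
  refine (norm_sub_le _ _).trans (add_le_add ?_ ?_)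
  · exact (hp.norm_sqrtWeight_groupMean_le hnonneg _).trans (hr u)
  · exact (hp.norm_sqrtWeight_groupMean_le hnonneg _).trans (hb v)

end Deviation

section Costs

section InnerProductSpace

variable {E : Type*} [NormedAddCommGroup E] [InnerProductSpace ℝ E]

lemma gradient_eq_zero_of_forall_le [CompleteSpace E] {J : E → ℝ} {x : E} (h : ∀ y, J x ≤ J y) :
    gradient J x = 0 := by
  rw [gradient, (IsLocalMin.fderiv_eq_zero (Eventually.of_forall h) : fderiv ℝ J x = 0), map_zero]

lemma isSymmetric_fderiv_gradient [CompleteSpace E] {J : E → ℝ} (hJ : Differentiable ℝ J)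
    (hJ' : Differentiable ℝ (gradient J)) (x : E) :
    (fderiv ℝ (gradient J) x).IsSymmetric := by
  intro u v
  have hderiv : HasFDerivAt (fun y => InnerProductSpace.toDual ℝ E (gradient J y))
      ((innerSL ℝ : E →L[ℝ] E →L[ℝ] ℝ).comp (fderiv ℝ (gradient J) x)) x :=
    (innerSL ℝ : E →L[ℝ] E →L[ℝ] ℝ).hasFDerivAt.comp x (hJ' x).hasFDerivAt
  have hsymm := second_derivative_symmetric (fun y => (hJ y).hasGradientAt.hasFDerivAt) hderiv u v
  exact hsymm.trans (real_inner_comm _ _)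

lemma norm_le_of_isSymmetric_of_abs_inner_le {T : E →L[ℝ] E} (hT : T.IsSymmetric) {L : ℝ}
    (hL : 0 ≤ L) (h : ∀ v, |inner ℝ (T v) v| ≤ L * ‖v‖ ^ 2) : ‖T‖ ≤ L := by
  rw [T.norm_eq_iSup_rayleighQuotient hT]
  refine ciSup_le fun v => ?_
  rw [ContinuousLinearMap.rayleighQuotient, abs_div, abs_sq]
  exact div_le_of_le_mul₀ (sq_nonneg _) hL (h v)

lemma mul_norm_sub_sq_le_inner_sub {f : E → E} (hf : Differentiable ℝ f) {c : ℝ}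
    (h : ∀ x v, c * ‖v‖ ^ 2 ≤ inner ℝ (fderiv ℝ f x v) v) (x y : E) :
    c * ‖x - y‖ ^ 2 ≤ inner ℝ (x - y) (f x - f y) := by
  set v := x - y
  have hline (t : ℝ) : HasDerivAt (fun t : ℝ => y + t • v) v t := by
    simpa using ((hasDerivAt_id t).smul_const v).const_add y
  have hderiv (t : ℝ) : HasDerivAt (fun t : ℝ => inner ℝ v (f (y + t • v)) - t * (c * ‖v‖ ^ 2))
      (inner ℝ v (fderiv ℝ f (y + t • v) v) - c * ‖v‖ ^ 2) t := by
    have hf' := (hf (y + t • v)).hasFDerivAt.comp_hasDerivAt t (hline t)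
    have hlin := (hasDerivAt_id t).mul_const (c * ‖v‖ ^ 2)
    rw [one_mul] at hlin
    exact ((innerSL ℝ v).hasFDerivAt.comp_hasDerivAt t hf').sub hlin
  have hmono := monotone_of_hasDerivAt_nonneg hderiv (fun t => by
    rw [Pi.zero_apply, sub_nonneg, real_inner_comm]
    exact h (y + t • v) v) zero_le_one
  simp only [zero_smul, add_zero, one_smul, zero_mul, one_mul, sub_zero, v, add_sub_cancel] at hmono
  rw [inner_sub_right]
  linarith

end InnerProductSpace

variable {N M : ℕ} {J : Fin N → Param M → ℝ} {wo : Fin N → Param M} {lam : Fin N → ℝ} {L : ℝ}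

lemma norm_hess_le {J : Param M → ℝ} (hJ : Differentiable ℝ J)
    (hJ' : Differentiable ℝ (gradient J)) {L : ℝ} (hL : 0 ≤ L) {w : Param M}
    (h0 : ∀ v, 0 ≤ inner ℝ (hess J w v) v) (hU : ∀ v, inner ℝ (hess J w v) v ≤ L * ‖v‖ ^ 2) :
    ‖hess J w‖ ≤ L :=
  norm_le_of_isSymmetric_of_abs_inner_le (isSymmetric_fderiv_gradient hJ hJ' w) hL fun v =>
    (abs_of_nonneg (h0 v)).trans_le (hU v)

lemma sectorBound_netHess (hlam : ∀ k w v, lam k * ‖v‖ ^ 2 ≤ inner ℝ (hess (J k) w v) v)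
    (hL : ∀ k w, ‖hess (J k) w‖ ≤ L) (W x : Stack N M) : SectorBound lam L x (netHess J W x) :=
  fun k => ⟨(hlam k (W k) (x k)).trans_eq (real_inner_comm _ _),
    ContinuousLinearMap.le_of_opNorm_le _ (hL k (W k)) (x k)⟩

/-- The stacked gradients `col{∇J_1(w_1), …, ∇J_N(w_N)}`, the exact update direction of the
diffusion strategy. -/
noncomputable def netGrad (J : Fin N → Param M → ℝ) (W : Stack N M) : Stack N M :=
  col fun k => gradient (J k) (W k)

lemma continuous_netGrad (hJ' : ∀ k, Differentiable ℝ (gradient (J k))) :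
    Continuous (netGrad J : Stack N M → Stack N M) :=
  (PiLp.continuous_toLp 2 _).comp (continuous_pi fun k =>
    (hJ' k).continuous.comp (PiLp.continuous_apply 2 _ k))

lemma sectorBound_netGrad (hJ' : ∀ k, Differentiable ℝ (gradient (J k)))
    (hwo : ∀ k, gradient (J k) (wo k) = 0)
    (hlam : ∀ k w v, lam k * ‖v‖ ^ 2 ≤ inner ℝ (hess (J k) w v) v)
    (hL : ∀ k w, ‖hess (J k) w‖ ≤ L) (W : Stack N M) :
    SectorBound lam L (W - col wo) (netGrad J W) := by
  intro k
  have hincr : gradient (J k) (W k) - gradient (J k) (wo k) = netGrad J W k := by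
    rw [hwo, sub_zero]; rfl
  rw [← hincr]
  exact ⟨mul_norm_sub_sq_le_inner_sub (hJ' k) (hlam k) (W k) (wo k),
    convex_univ.norm_image_sub_le_of_norm_fderiv_le (fun w _ => hJ' k w) (fun w _ => hL k w)
      trivial trivial⟩

end Costs

section RootMeanSquare

variable {Ω E H : Type*} {mΩ : MeasurableSpace Ω} {P : Measure Ω}
  [NormedAddCommGroup E] [NormedSpace ℝ E] [NormedAddCommGroup H]

section NormedSpace

variable {E₁ E₂ H₁ H₂ : Type*} [NormedSpace ℝ H]
  [NormedAddCommGroup E₁] [NormedSpace ℝ E₁] [NormedAddCommGroup H₁] [NormedSpace ℝ H₁]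
  [NormedAddCommGroup E₂] [NormedSpace ℝ E₂] [NormedAddCommGroup H₂] [NormedSpace ℝ H₂]

/-- The root mean square `√(E ‖D X‖²)` of the image under `D` of the random vector `X`. -/
noncomputable def rms (P : Measure Ω) (D : E →L[ℝ] H) (X : Ω → E) : ℝ :=
  lpNorm (D ∘ X) 2 P

lemma rms_nonneg (D : E →L[ℝ] H) (X : Ω → E) : 0 ≤ rms P D X := lpNorm_nonneg

lemma rms_sq (D : E →L[ℝ] H) {X : Ω → E} (hX : MemLp X 2 P) :
    rms P D X ^ 2 = ∫ ω, ‖D (X ω)‖ ^ 2 ∂P := by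
  have hnonneg : 0 ≤ ∫ ω, ‖D (X ω)‖ ^ 2 ∂P := integral_nonneg fun ω => by positivity
  rw [rms, lpNorm_eq_integral_norm_rpow_toReal two_ne_zero ENNReal.ofNat_ne_top
    (D.comp_memLp' hX).aestronglyMeasurable]
  simp only [ENNReal.toReal_ofNat, Real.rpow_ofNat, Function.comp_apply]
  rw [← one_div, ← Real.sqrt_eq_rpow, Real.sq_sqrt hnonneg]

lemma lintegral_enorm_sq_eq_rms_sq {X : Ω → E} (hX : MemLp X 2 P) :
    ∫⁻ ω, ‖X ω‖ₑ ^ 2 ∂P = ENNReal.ofReal (rms P (.id ℝ E) X ^ 2) := by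
  rw [rms_sq _ hX]
  simp only [ContinuousLinearMap.id_apply]
  rw [ofReal_integral_eq_lintegral_ofReal (hX.integrable_norm_pow two_ne_zero)
    (ae_of_all _ fun ω => by positivity)]
  simp only [ENNReal.ofReal_pow (norm_nonneg _), ofReal_norm]

lemma rms_le_mul_add_mul {D : E →L[ℝ] H} {D₁ : E₁ →L[ℝ] H₁} {D₂ : E₂ →L[ℝ] H₂} {Z : Ω → E}
    {X : Ω → E₁} {Y : Ω → E₂} {a b : ℝ} (ha : 0 ≤ a) (hb : 0 ≤ b) (hX : MemLp X 2 P)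
    (hY : MemLp Y 2 P) (h : ∀ ω, ‖D (Z ω)‖ ≤ a * ‖D₁ (X ω)‖ + b * ‖D₂ (Y ω)‖) :
    rms P D Z ≤ a * rms P D₁ X + b * rms P D₂ Y := by
  have hXL := (D₁.comp_memLp' hX).norm.const_smul a
  have hYL := (D₂.comp_memLp' hY).norm.const_smul b
  refine (lpNorm_mono_real (hXL.add hYL) h).trans ((lpNorm_add_le hXL one_le_two).trans_eq ?_)
  rw [lpNorm_const_smul, lpNorm_const_smul, lpNorm_norm (D₁.comp_memLp' hX).aestronglyMeasurable,
    lpNorm_norm (D₂.comp_memLp' hY).aestronglyMeasurable, coe_nnnorm, coe_nnnorm,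
    Real.norm_of_nonneg ha, Real.norm_of_nonneg hb, rms, rms]

lemma rms_le_mul {D : E →L[ℝ] H} {D₁ : E₁ →L[ℝ] H₁} {Z : Ω → E} {X : Ω → E₁} {a : ℝ} (ha : 0 ≤ a)
    (hX : MemLp X 2 P) (h : ∀ ω, ‖D (Z ω)‖ ≤ a * ‖D₁ (X ω)‖) : rms P D Z ≤ a * rms P D₁ X := by
  simpa using rms_le_mul_add_mul (b := 0) (D₂ := D₁) ha le_rfl hX hX (by simpa using h)

end NormedSpace

lemma condExp_clm_comp_eq_zero [CompleteSpace E] [NormedSpace ℝ H] [CompleteSpace H]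
    {m : MeasurableSpace Ω} {S : Ω → E} (hS : Integrable S P) (hzero : P[S | m] =ᵐ[P] 0)
    (T : E →L[ℝ] H) : P[T ∘ S | m] =ᵐ[P] 0 := by
  filter_upwards [T.comp_condExp_comm (m := m) hS, hzero] with ω h₁ h₂
  rw [Function.comp_apply, h₂, Pi.zero_apply, map_zero] at h₁
  exact h₁.symm

lemma rms_add_sq_of_condExp_eq_zero [IsFiniteMeasure P] [CompleteSpace E]
    [InnerProductSpace ℝ H] [CompleteSpace H] (D : E →L[ℝ] H) {m : MeasurableSpace Ω} (hm : m ≤ mΩ)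
    {X S : Ω → E} (hXm : StronglyMeasurable[m] X) (hX : MemLp X 2 P) (hS : MemLp S 2 P)
    (hzero : P[S | m] =ᵐ[P] 0) :
    rms P D (X + S) ^ 2 = rms P D X ^ 2 + rms P D S ^ 2 := by
  have hDX := D.comp_memLp' hX
  have hDS := D.comp_memLp' hS
  have hcond : P[fun ω => D (S ω) | m] =ᵐ[P] 0 :=
    condExp_clm_comp_eq_zero (hS.integrable one_le_two) hzero D
  have hint : Integrable (fun ω => inner ℝ (D (X ω)) (D (S ω))) P :=
    memLp_one_iff_integrable.1 ((innerSL ℝ : H →L[ℝ] H →L[ℝ] ℝ).memLp_of_bilin 1 hDX hDS)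
  have hcross : ∫ ω, inner ℝ (D (X ω)) (D (S ω)) ∂P = 0 := by
    rw [← integral_condExp hm]
    refine integral_eq_zero_of_ae ?_
    filter_upwards [condExp_bilin_of_stronglyMeasurable_left (innerSL ℝ)
      (D.continuous.comp_stronglyMeasurable hXm) hint (hDS.integrable one_le_two), hcond]
      with ω h₁ h₂
    rw [h₂, Pi.zero_apply, map_zero] at h₁
    exact h₁
  have hX2 : Integrable (fun ω => ‖D (X ω)‖ ^ 2) P := hDX.integrable_norm_pow two_ne_zero
  have hS2 : Integrable (fun ω => ‖D (S ω)‖ ^ 2) P := hDS.integrable_norm_pow two_ne_zero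
  rw [rms_sq D (hX.add hS), rms_sq D hX, rms_sq D hS]
  simp only [Pi.add_apply, map_add, norm_add_sq_real]
  rw [integral_add (hX2.fun_add (hint.const_mul 2)) hS2, integral_add hX2 (hint.const_mul 2),
    integral_const_mul, hcross, mul_zero, add_zero]

end RootMeanSquare

lemma eventually_le_of_recursion {a : ℕ → ℝ} {r b : ℝ} (hr : 0 ≤ r) (hr' : r < 1) (hb : 0 < b)
    (h : ∀ᶠ n in atTop, a (n + 1) ≤ r * a n + b) : ∀ᶠ n in atTop, a n ≤ 2 * b / (1 - r) := by
  obtain ⟨n₀, hn₀⟩ := eventually_atTop.1 h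
  have hgap : 0 < 1 - r := sub_pos.2 hr'
  set B := b / (1 - r) with hB
  have hfix : r * B + b = B := by rw [hB]; field_simp; ring
  have hdecay (j : ℕ) : a (n₀ + j) - B ≤ r ^ j * |a n₀ - B| := by
    induction j with
    | zero => simpa using le_abs_self (a n₀ - B)
    | succ j ih =>
      have hstep := hn₀ (n₀ + j) (Nat.le_add_right _ _)
      have hcontract := mul_le_mul_of_nonneg_left ih hr
      rw [pow_succ', mul_assoc, ← Nat.add_assoc]
      linarith
  have hlim : Tendsto (fun j => r ^ j * |a n₀ - B|) atTop (𝓝 0) := by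
    simpa using (tendsto_pow_atTop_nhds_zero_of_lt_one hr hr').mul_const |a n₀ - B|
  have htail : ∀ᶠ j in atTop, a (j + n₀) ≤ 2 * b / (1 - r) := by
    filter_upwards [hlim.eventually (ge_mem_nhds (show 0 < B by positivity))] with j hj
    rw [mul_div_assoc, ← hB, add_comm j]
    linarith [hdecay j]
  rwa [← map_add_atTop_eq_nat n₀, eventually_map]

section MartingaleDifference

variable {Ω E E' H : Type*} {mΩ : MeasurableSpace Ω} {P : Measure Ω} {F : Filtration ℕ mΩ}
  [NormedAddCommGroup E] [NormedSpace ℝ E] [NormedAddCommGroup E'] [NormedSpace ℝ E']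

/-- A square-integrable martingale difference sequence, indexed so that the increment `S n` is
revealed at time `n + 1`. -/
structure IsMartingaleDifference (P : Measure Ω) (F : Filtration ℕ mΩ) (S : ℕ → Ω → E) : Prop where
  stronglyMeasurable : ∀ n, StronglyMeasurable[F (n + 1)] (S n)
  memLp_two : ∀ n, MemLp (S n) 2 P
  condExp_eq_zero : ∀ n, P[S n | F n] =ᵐ[P] 0

lemma IsMartingaleDifference.clm_comp [IsFiniteMeasure P] [CompleteSpace E] [CompleteSpace E']
    {S : ℕ → Ω → E} (hS : IsMartingaleDifference P F S) (T : E →L[ℝ] E') :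
    IsMartingaleDifference P F fun n => T ∘ S n where
  stronglyMeasurable n := T.continuous.comp_stronglyMeasurable (hS.stronglyMeasurable n)
  memLp_two n := T.comp_memLp' (hS.memLp_two n)
  condExp_eq_zero n :=
    condExp_clm_comp_eq_zero ((hS.memLp_two n).integrable one_le_two) (hS.condExp_eq_zero n) T

/-- The solution of `Z⁺ = B Z + S` started at zero. Unlike a solution with an arbitrary random
initial state, it is adapted to the filtration that reveals `S`. -/
noncomputable def zeroStart (B : E →L[ℝ] E) (S : ℕ → Ω → E) : ℕ → Ω → E
  | 0 => 0
  | n + 1 => B ∘ zeroStart B S n + S n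

lemma stronglyMeasurable_zeroStart {S : ℕ → Ω → E} (hS : IsMartingaleDifference P F S)
    (B : E →L[ℝ] E) : ∀ n, StronglyMeasurable[F n] (zeroStart B S n)
  | 0 => stronglyMeasurable_zero
  | n + 1 => (B.continuous.comp_stronglyMeasurable
      ((stronglyMeasurable_zeroStart hS B n).mono (F.mono n.le_succ))).add (hS.stronglyMeasurable n)

lemma memLp_linearRecursion {B : E →L[ℝ] E} {S X : ℕ → Ω → E} (hS : ∀ n, MemLp (S n) 2 P)
    (hX₀ : MemLp (X 0) 2 P) (hX : ∀ n, X (n + 1) = B ∘ X n + S n) : ∀ n, MemLp (X n) 2 P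
  | 0 => hX₀
  | n + 1 => hX n ▸ (B.comp_memLp' (memLp_linearRecursion hS hX₀ hX n)).add (hS n)

lemma memLp_zeroStart {S : ℕ → Ω → E} (hS : ∀ n, MemLp (S n) 2 P) (B : E →L[ℝ] E) :
    ∀ n, MemLp (zeroStart B S n) 2 P :=
  memLp_linearRecursion hS .zero' fun _ => rfl

variable [NormedAddCommGroup H] [InnerProductSpace ℝ H] [IsFiniteMeasure P]
  [CompleteSpace E] [CompleteSpace H] {D : E →L[ℝ] H} {B : E →L[ℝ] E} {S : ℕ → Ω → E} {r s : ℝ}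

lemma eventually_rms_zeroStart_sq_le (hS : IsMartingaleDifference P F S) (hr : 0 ≤ r) (hr' : r < 1)
    (hB : ∀ x, ‖D (B x)‖ ≤ r * ‖D x‖) (hs : 0 < s) (hSs : ∀ᶠ n in atTop, rms P D (S n) ≤ s) :
    ∀ᶠ n in atTop, rms P D (zeroStart B S n) ^ 2 ≤ 2 * s ^ 2 / (1 - r) := by
  refine eventually_le_of_recursion hr hr' (by positivity) (hSs.mono fun n hn => ?_)
  have hZ := memLp_zeroStart hS.memLp_two B n
  have hBZ : StronglyMeasurable[F n] (B ∘ zeroStart B S n) :=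
    B.continuous.comp_stronglyMeasurable (stronglyMeasurable_zeroStart hS B n)
  rw [zeroStart, rms_add_sq_of_condExp_eq_zero D (F.le n) hBZ (B.comp_memLp' hZ) (hS.memLp_two n)
    (hS.condExp_eq_zero n)]
  have hcontract : rms P D (B ∘ zeroStart B S n) ≤ r * rms P D (zeroStart B S n) :=
    rms_le_mul hr hZ fun ω => hB _
  have hsq : r ^ 2 * rms P D (zeroStart B S n) ^ 2 ≤ r * rms P D (zeroStart B S n) ^ 2 :=
    mul_le_mul_of_nonneg_right (by nlinarith) (sq_nonneg _)
  gcongr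
  · exact (pow_le_pow_left₀ (rms_nonneg _ _) hcontract 2).trans (by rwa [mul_pow])
  · exact rms_nonneg _ _

lemma eventually_rms_linearRecursion_le (hS : IsMartingaleDifference P F S) {X : ℕ → Ω → E}
    (hX₀ : MemLp (X 0) 2 P) (hX : ∀ n, X (n + 1) = B ∘ X n + S n) (hr : 0 ≤ r) (hr' : r < 1)
    (hB : ∀ x, ‖D (B x)‖ ≤ r * ‖D x‖) (hs : 0 < s) (hSs : ∀ᶠ n in atTop, rms P D (S n) ≤ s) :
    ∀ᶠ n in atTop, rms P D (X n) ≤ √(2 * s ^ 2 / (1 - r)) + 1 := by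
  have hXL := memLp_linearRecursion hS.memLp_two hX₀ hX
  have hZL := memLp_zeroStart hS.memLp_two B
  have hforget : ∀ᶠ n in atTop, rms P D (X n - zeroStart B S n) ≤ 2 * ((1 - r) / 2) / (1 - r) := by
    have : 0 < 1 - r := sub_pos.2 hr'
    refine eventually_le_of_recursion hr hr' (by positivity) (Eventually.of_forall fun n => ?_)
    have hstep : rms P D (X (n + 1) - zeroStart B S (n + 1))
        ≤ r * rms P D (X n - zeroStart B S n) := by
      refine rms_le_mul hr ((hXL n).sub (hZL n)) fun ω => ?_
      have hdiff : (X (n + 1) - zeroStart B S (n + 1)) ω = B ((X n - zeroStart B S n) ω) := by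
        simp only [hX, zeroStart, add_sub_add_right_eq_sub, Pi.sub_apply, Pi.add_apply,
          Function.comp_apply, map_sub]
      rw [hdiff]
      exact hB _
    linarith
  filter_upwards [hforget, eventually_rms_zeroStart_sq_le hS hr hr' hB hs hSs] with n hdiff hzero
  have hsplit : rms P D (X n)
      ≤ 1 * rms P D (zeroStart B S n) + 1 * rms P D (X n - zeroStart B S n) :=
    rms_le_mul_add_mul zero_le_one zero_le_one (hZL n) ((hXL n).sub (hZL n)) fun ω => by
      rw [one_mul, one_mul, Pi.sub_apply, map_sub]
      exact norm_le_insert' _ _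
  have hroot := Real.le_sqrt_of_sq_le hzero
  rw [mul_div_cancel₀ _ two_ne_zero, div_self (sub_pos.2 hr').ne'] at hdiff
  linarith

end MartingaleDifference

section NoisyContraction

variable {Ω E H : Type*} {mΩ : MeasurableSpace Ω} {P : Measure Ω}
  {F : Filtration ℕ mΩ} [NormedAddCommGroup E] {s : ℕ → Ω → E → E} {x₀ : E} {α σ : ℝ}

lemma memLp_comp_sub_of_norm_sub_le [IsFiniteMeasure P] {Φ : E → E} (hΦ : Continuous Φ) {K : ℝ}
    (hK : ∀ x, ‖Φ x - x₀‖ ≤ K * ‖x - x₀‖) {X : Ω → E} {q : ENNReal} (hX : MemLp X q P) :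
    MemLp (fun ω => Φ (X ω) - x₀) q P :=
  (hX.sub (memLp_const x₀)).of_le_mul
    ((hΦ.comp_aestronglyMeasurable hX.aestronglyMeasurable).sub aestronglyMeasurable_const)
    (ae_of_all _ fun ω => hK (X ω))

variable [IsProbabilityMeasure P]

lemma integral_norm_sq_le_of_condExp_pow_four_le {m : MeasurableSpace Ω} {U S : Ω → E}
    (hα : 0 ≤ α) (hm : m ≤ mΩ) (hU : MemLp U 4 P) (hS : MemLp S 4 P)
    (h : P[fun ω => ‖S ω‖ ^ 4 | m] ≤ᵐ[P] fun ω => α ^ 2 * ‖U ω‖ ^ 4 + σ ^ 4) :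
    ∫ ω, ‖S ω‖ ^ 2 ∂P ≤ α * ∫ ω, ‖U ω‖ ^ 2 ∂P + σ ^ 2 := by
  have hsq {X : Ω → E} (hX : MemLp X 4 P) : Integrable (fun ω => ‖X ω‖ ^ 2) P :=
    (hX.mono_exponent (by norm_num)).integrable_norm_pow two_ne_zero
  have hpow (x : E) : (‖x‖ ^ 2) ^ 2 = ‖x‖ ^ 4 := by ring
  have hjensen : (fun ω => P[fun ω => ‖S ω‖ ^ 2 | m] ω ^ 2) ≤ᵐ[P] P[fun ω => ‖S ω‖ ^ 4 | m] := by
    have hS4 : Integrable ((· ^ 2) ∘ fun ω => ‖S ω‖ ^ 2) P := by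
      simpa only [Function.comp_def, hpow] using hS.integrable_norm_pow (by norm_num)
    simpa only [Function.comp_def, hpow] using
      (even_two.convexOn_pow (𝕜 := ℝ)).map_condExp_le_univ hm
        (continuous_pow 2).lowerSemicontinuous (hsq hS) hS4
  have hcond : P[fun ω => ‖S ω‖ ^ 2 | m] ≤ᵐ[P] fun ω => α * ‖U ω‖ ^ 2 + σ ^ 2 := by
    filter_upwards [hjensen, h] with ω h₁ h₂
    have hcross : 0 ≤ α * ‖U ω‖ ^ 2 * σ ^ 2 := by positivity
    exact le_of_sq_le_sq (by nlinarith) (by positivity)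
  calc ∫ ω, ‖S ω‖ ^ 2 ∂P = ∫ ω, P[fun ω => ‖S ω‖ ^ 2 | m] ω ∂P := (integral_condExp hm).symm
    _ ≤ ∫ ω, α * ‖U ω‖ ^ 2 + σ ^ 2 ∂P :=
      integral_mono_ae integrable_condExp (((hsq hU).const_mul α).add (integrable_const _)) hcond
    _ = α * ∫ ω, ‖U ω‖ ^ 2 ∂P + σ ^ 2 := by
      rw [integral_add ((hsq hU).const_mul α) (integrable_const _), integral_const_mul,
        integral_const, probReal_univ, one_smul]

variable [NormedSpace ℝ E]

lemma norm_sub_le_of_norm_map_sub_le [NormedAddCommGroup H] [NormedSpace ℝ H] {D : E →L[ℝ] H}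
    {Φ : E → E} {C r : ℝ} (hC : 0 ≤ C) (hr : 0 ≤ r) (hDC : ∀ x, ‖x‖ ≤ C * ‖D x‖)
    (hΦr : ∀ x, ‖D (Φ x - x₀)‖ ≤ r * ‖D (x - x₀)‖) (x : E) :
    ‖Φ x - x₀‖ ≤ C * (r * ‖D‖) * ‖x - x₀‖ :=
  calc ‖Φ x - x₀‖ ≤ C * ‖D (Φ x - x₀)‖ := hDC _
    _ ≤ C * (r * ‖D (x - x₀)‖) := by gcongr; exact hΦr x
    _ ≤ C * (r * (‖D‖ * ‖x - x₀‖)) := by gcongr; exact D.le_opNorm _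
    _ = C * (r * ‖D‖) * ‖x - x₀‖ := by ring

/-- Zero-mean noise `s n · x` that perturbs at time `n` any state `x` depending on the past, and
whose conditional fourth moment grows at most like that of the distance of `x` to `x₀`. -/
structure IsRelativeNoise (P : Measure Ω) (F : Filtration ℕ mΩ) (s : ℕ → Ω → E → E) (x₀ : E)
    (α σ : ℝ) : Prop where
  stronglyMeasurable : ∀ (n : ℕ) (W : Ω → E), StronglyMeasurable[F n] W →
    StronglyMeasurable[F (n + 1)] fun ω => s n ω (W ω)
  condExp_eq_zero : ∀ (n : ℕ) (W : Ω → E), StronglyMeasurable[F n] W → MemLp W 4 P →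
    P[fun ω => s n ω (W ω) | F n] =ᵐ[P] 0
  memLp_four : ∀ (n : ℕ) (W : Ω → E), StronglyMeasurable[F n] W → MemLp W 4 P →
    MemLp (fun ω => s n ω (W ω)) 4 P
  condExp_pow_four_le : ∀ (n : ℕ) (W : Ω → E), StronglyMeasurable[F n] W → MemLp W 4 P →
    P[fun ω => ‖s n ω (W ω)‖ ^ 4 | F n] ≤ᵐ[P] fun ω => α ^ 2 * ‖W ω - x₀‖ ^ 4 + σ ^ 4

variable (hs : IsRelativeNoise P F s x₀ α σ)
include hs

lemma IsRelativeNoise.isMartingaleDifference {W : ℕ → Ω → E}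
    (hWm : ∀ n, StronglyMeasurable[F n] (W n)) (hW : ∀ n, MemLp (W n) 4 P) :
    IsMartingaleDifference P F fun n ω => s n ω (W n ω) where
  stronglyMeasurable n := hs.stronglyMeasurable n _ (hWm n)
  memLp_two n := (hs.memLp_four n _ (hWm n) (hW n)).mono_exponent (by norm_num)
  condExp_eq_zero n := hs.condExp_eq_zero n _ (hWm n) (hW n)

lemma IsRelativeNoise.rms_sq_le (hα : 0 ≤ α) {n : ℕ} {W : Ω → E}
    (hWm : StronglyMeasurable[F n] W) (hW : MemLp W 4 P) :
    rms P (.id ℝ E) (fun ω => s n ω (W ω)) ^ 2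
      ≤ α * rms P (.id ℝ E) (fun ω => W ω - x₀) ^ 2 + σ ^ 2 := by
  have hW' : MemLp (fun ω => W ω - x₀) 4 P := hW.sub (memLp_const x₀)
  have hS := hs.memLp_four n W hWm hW
  rw [rms_sq _ (hS.mono_exponent (by norm_num)), rms_sq _ (hW'.mono_exponent (by norm_num))]
  exact integral_norm_sq_le_of_condExp_pow_four_le hα (F.le n) hW' hS
    (hs.condExp_pow_four_le n W hWm hW)

variable {Φ : E → E} {T : E →L[ℝ] E} {W : ℕ → Ω → E}
  (hWΦ : ∀ n ω, W (n + 1) ω = Φ (W n ω) + T (s n ω (W n ω)))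
include hWΦ

lemma IsRelativeNoise.stronglyMeasurable_and_memLp_four (hW₀m : StronglyMeasurable[F 0] (W 0))
    (hW₀ : MemLp (W 0) 4 P) (hΦ : Continuous Φ) {K : ℝ} (hK : ∀ x, ‖Φ x - x₀‖ ≤ K * ‖x - x₀‖) :
    ∀ n, StronglyMeasurable[F n] (W n) ∧ MemLp (W n) 4 P
  | 0 => ⟨hW₀m, hW₀⟩
  | n + 1 => by
    obtain ⟨hm, hL⟩ := stronglyMeasurable_and_memLp_four hW₀m hW₀ hΦ hK n
    have hrec : W (n + 1) = (fun ω => Φ (W n ω)) + T ∘ fun ω => s n ω (W n ω) := funext (hWΦ n)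
    have hΦm : StronglyMeasurable[F n] fun ω => Φ (W n ω) := hΦ.comp_stronglyMeasurable hm
    have hΦL : MemLp (fun ω => Φ (W n ω)) 4 P := by
      convert (memLp_comp_sub_of_norm_sub_le hΦ hK hL).add (memLp_const x₀) using 1
      funext ω
      exact (sub_add_cancel _ _).symm
    rw [hrec]
    exact ⟨(hΦm.mono (F.mono n.le_succ)).add
      (T.continuous.comp_stronglyMeasurable (hs.stronglyMeasurable n _ hm)),
      hΦL.add (T.comp_memLp' (hs.memLp_four n _ hm hL))⟩

variable [NormedAddCommGroup H] [InnerProductSpace ℝ H] [CompleteSpace E] [CompleteSpace H]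
  {D : E →L[ℝ] H} {b C r R : ℝ}

lemma IsRelativeNoise.rms_sub_sq_succ_le (hα : 0 ≤ α) (hC : 0 ≤ C) (hr : 0 ≤ r) (hb : 0 ≤ b)
    (hDC : ∀ x, ‖x‖ ≤ C * ‖D x‖) (hΦ : Continuous Φ)
    (hΦr : ∀ x, ‖D (Φ x - x₀)‖ ≤ r * ‖D (x - x₀)‖) (hTb : ∀ x, ‖D (T x)‖ ≤ b * ‖x‖) {n : ℕ}
    (hWm : StronglyMeasurable[F n] (W n)) (hW : MemLp (W n) 4 P) :
    rms P D (fun ω => W (n + 1) ω - x₀) ^ 2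
      ≤ (r ^ 2 + b ^ 2 * (α * C ^ 2)) * rms P D (fun ω => W n ω - x₀) ^ 2 + b ^ 2 * σ ^ 2 := by
  set U := fun ω => W n ω - x₀
  set V := fun ω => Φ (W n ω) - x₀
  set S := fun ω => s n ω (W n ω)
  have hW2 : MemLp (W n) 2 P := hW.mono_exponent (by norm_num)
  have hU : MemLp U 2 P := hW2.sub (memLp_const x₀)
  have hV : MemLp V 2 P :=
    memLp_comp_sub_of_norm_sub_le hΦ (norm_sub_le_of_norm_map_sub_le hC hr hDC hΦr) hW2
  have hVm : StronglyMeasurable[F n] V :=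
    (hΦ.comp_stronglyMeasurable hWm).sub stronglyMeasurable_const
  have hS : MemLp S 2 P := (hs.memLp_four n _ hWm hW).mono_exponent (by norm_num)
  have hzero : P[T ∘ S | F n] =ᵐ[P] 0 :=
    condExp_clm_comp_eq_zero (hS.integrable one_le_two) (hs.condExp_eq_zero n _ hWm hW) T
  have hrec : (fun ω => W (n + 1) ω - x₀) = V + T ∘ S := by
    funext ω
    rw [hWΦ, add_sub_right_comm]
    rfl
  have hrV : rms P D V ≤ r * rms P D U := rms_le_mul hr hU fun ω => hΦr (W n ω)
  have hTS : rms P D (T ∘ S) ≤ b * rms P (.id ℝ E) S := rms_le_mul hb hS fun ω => hTb (S ω)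
  have hUC : rms P (.id ℝ E) U ≤ C * rms P D U := rms_le_mul hC hU fun ω => hDC (U ω)
  have hSU : rms P (.id ℝ E) S ^ 2 ≤ α * rms P (.id ℝ E) U ^ 2 + σ ^ 2 := hs.rms_sq_le hα hWm hW
  calc rms P D (fun ω => W (n + 1) ω - x₀) ^ 2
      = rms P D V ^ 2 + rms P D (T ∘ S) ^ 2 := by
        rw [hrec, rms_add_sq_of_condExp_eq_zero D (F.le n) hVm hV (T.comp_memLp' hS) hzero]
    _ ≤ (r * rms P D U) ^ 2 + b ^ 2 * (α * (C * rms P D U) ^ 2 + σ ^ 2) := by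
        refine add_le_add (pow_le_pow_left₀ (rms_nonneg _ _) hrV 2) ?_
        refine (pow_le_pow_left₀ (rms_nonneg _ _) hTS 2).trans ?_
        rw [mul_pow]
        refine mul_le_mul_of_nonneg_left (hSU.trans ?_) (sq_nonneg b)
        gcongr
        exact rms_nonneg _ _
    _ = (r ^ 2 + b ^ 2 * (α * C ^ 2)) * rms P D U ^ 2 + b ^ 2 * σ ^ 2 := by ring

lemma IsRelativeNoise.eventually_rms_sq_le (hα : 0 ≤ α) (hC : 0 ≤ C) (hr : 0 ≤ r) (hb : 0 < b)
    (hDC : ∀ x, ‖x‖ ≤ C * ‖D x‖) (hΦ : Continuous Φ)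
    (hΦr : ∀ x, ‖D (Φ x - x₀)‖ ≤ r * ‖D (x - x₀)‖) (hTb : ∀ x, ‖D (T x)‖ ≤ b * ‖x‖)
    (hR : r ^ 2 + b ^ 2 * (α * C ^ 2) ≤ R) (hR' : R < 1)
    (hW : ∀ n, StronglyMeasurable[F n] (W n) ∧ MemLp (W n) 4 P) :
    ∀ᶠ n in atTop, rms P (.id ℝ E) (fun ω => s n ω (W n ω)) ^ 2
      ≤ α * C ^ 2 * (2 * (b ^ 2 * (σ ^ 2 + 1)) / (1 - R)) + σ ^ 2 := by
  have hR₀ : 0 ≤ R := le_trans (by positivity) hR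
  have herror : ∀ᶠ n in atTop, rms P D (fun ω => W n ω - x₀) ^ 2
      ≤ 2 * (b ^ 2 * (σ ^ 2 + 1)) / (1 - R) := by
    refine eventually_le_of_recursion hR₀ hR' (by positivity) (Eventually.of_forall fun n => ?_)
    refine (hs.rms_sub_sq_succ_le hWΦ hα hC hr hb.le hDC hΦ hΦr hTb (hW n).1 (hW n).2).trans ?_
    gcongr
    exact le_add_of_nonneg_right zero_le_one
  filter_upwards [herror] with n hn
  have hWL : MemLp (fun ω => W n ω - x₀) 2 P :=
    ((hW n).2.sub (memLp_const x₀)).mono_exponent (by norm_num)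
  have hWC := pow_le_pow_left₀ (rms_nonneg _ _)
    (rms_le_mul (P := P) (D := .id ℝ E) (Z := fun ω => W n ω - x₀) hC hWL fun ω => hDC _) 2
  refine (hs.rms_sq_le hα (hW n).1 (hW n).2).trans ?_
  rw [mul_assoc]
  gcongr
  refine hWC.trans ?_
  rw [mul_pow]
  gcongr

end NoisyContraction

section Centroid

variable {Ω : Type*} {mΩ : MeasurableSpace Ω} {P : Measure Ω} {N G M : ℕ}
  {Gr : SimpleGraph (Fin N)} {group : Fin N → Fin G} {A : Matrix (Fin N) (Fin N) ℝ}
  {p : Fin N → ℝ} (hA : IsCombinationMatrix Gr group A) (hp : IsPerronVector group A p)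
  (hnonneg : ∀ k, 0 ≤ p k)
include hA hp hnonneg

lemma eventually_rms_groupDeviation_le {ρ : ℝ} (hρ : 0 ≤ ρ) (hρ' : ρ < 1)
    (hmix : ∀ x : Stack N M, groupMean group p x = 0 →
      ‖sqrtWeight p (bigAT A x)‖ ≤ ρ * ‖sqrtWeight p x‖)
    {X E : ℕ → Ω → Stack N M} (hX : ∀ n, MemLp (X n) 2 P) (hE : ∀ n, MemLp (E n) 2 P)
    (hXE : ∀ n ω, X (n + 1) ω = bigAT A (X n ω + E n ω)) {ε : ℝ} (hε : 0 < ε)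
    (hEε : ∀ᶠ n in atTop, rms P (sqrtWeight p) (E n) ≤ ε) :
    ∀ᶠ n in atTop,
      rms P ((sqrtWeight p).comp (groupDeviation group p)) (X n) ≤ 2 * (2 * ε) / (1 - ρ) := by
  refine eventually_le_of_recursion hρ hρ' (by positivity) (hEε.mono fun n hn => ?_)
  refine (rms_le_mul_add_mul hρ zero_le_two (hX n) (hE n) fun ω => ?_).trans
    (add_le_add_right (mul_le_mul_of_nonneg_left hn zero_le_two) _)
  rw [hXE]
  exact norm_sqrtWeight_groupDeviation_bigAT_add_le hA hp hnonneg hmix (X n ω) (E n ω)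

lemma eventually_rms_le_of_groupMean_succ {T : Stack N M →L[ℝ] Stack N M} {r b : ℝ}
    (hr : 0 ≤ r) (hr' : r < 1) (hb : 0 < b)
    (hTr : ∀ x, ‖sqrtWeight p (bigAT A (x - T x))‖ ≤ r * ‖sqrtWeight p x‖)
    (hTb : ∀ x, ‖sqrtWeight p (T x)‖ ≤ b * ‖sqrtWeight p x‖)
    {Z : ℕ → Ω → Stack N M} (hZ : ∀ n, MemLp (Z n) 2 P)
    (hZT : ∀ n ω, groupMean group p (Z (n + 1) ω)
      = groupMean group p (bigAT A (Z n ω - T (Z n ω)))) {δ : ℝ} (hδ : 0 < δ)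
    (hZδ : ∀ᶠ n in atTop, rms P ((sqrtWeight p).comp (groupDeviation group p)) (Z n) ≤ δ) :
    ∀ᶠ n in atTop, rms P (sqrtWeight p) (Z n) ≤ 2 * (b * δ) / (1 - r) + δ := by
  have hmean : ∀ᶠ n in atTop,
      rms P ((sqrtWeight p).comp (groupMean group p)) (Z n) ≤ 2 * (b * δ) / (1 - r) := by
    refine eventually_le_of_recursion hr hr' (by positivity) (hZδ.mono fun n hn => ?_)
    refine (rms_le_mul_add_mul hr hb.le (hZ n) (hZ n) fun ω => ?_).trans
      (add_le_add_right (mul_le_mul_of_nonneg_left hn hb.le) _)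
    rw [ContinuousLinearMap.comp_apply, hZT]
    exact norm_sqrtWeight_groupMean_bigAT_sub_le hA hp hnonneg hTr hTb (Z n ω)
  filter_upwards [hmean, hZδ] with n hn hn'
  refine (rms_le_mul_add_mul zero_le_one zero_le_one (hZ n) (hZ n) fun ω => ?_).trans
    (add_le_add ((one_mul _).trans_le hn) ((one_mul _).trans_le hn'))
  rw [one_mul, one_mul, ← groupMean_add_groupDeviation (group := group) (p := p) (Z n ω), map_add,
    groupMean_add_groupDeviation]
  exact norm_add_le _ _

end Centroid

section Iterates

variable {Ω : Type*} {mΩ : MeasurableSpace Ω} {P : Measure Ω} {F : Filtration ℕ mΩ} {N M : ℕ}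
  {J : Fin N → Param M → ℝ} {wo : Fin N → Param M} {ghat : ℕ → Ω → Fin N → Param M → Param M}
  {A : Matrix (Fin N) (Fin N) ℝ} {p lam μ : Fin N → ℝ} {L : ℝ}

lemma NoiseAssumption.exists_isRelativeNoise (hNoise : NoiseAssumption P F J wo ghat) :
    ∃ α σ : ℝ, 0 ≤ α ∧ IsRelativeNoise P F (noise J ghat) (col wo) α σ := by
  obtain ⟨α, σ, hα, -, hfourth⟩ := hNoise.fourth_moment
  refine ⟨α, σ, hα, hNoise.adapted, hNoise.martingale_diff,
    fun n W hWm hW => (hfourth n W hWm hW).1, fun n W hWm hW => ?_⟩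
  simpa only [norm_sub_rev] using (hfourth n W hWm hW).2

/-- The update `W ↦ 𝓐ᵀ (W - 𝓜 col{∇J_k(w_k)})` of the diffusion strategy with exact gradients. -/
noncomputable def diffusionMap (J : Fin N → Param M → ℝ) (A : Matrix (Fin N) (Fin N) ℝ)
    (μ : Fin N → ℝ) (W : Stack N M) : Stack N M :=
  bigAT A (W - bigM μ (netGrad J W))

lemma continuous_diffusionMap (hJ' : ∀ k, Differentiable ℝ (gradient (J k))) :
    Continuous (diffusionMap J A μ : Stack N M → Stack N M) :=
  (bigAT A).continuous.comp
    (continuous_id.sub ((bigM μ).continuous.comp (continuous_netGrad hJ')))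

lemma atc_succ (J : Fin N → Param M → ℝ) (ghat : ℕ → Ω → Fin N → Param M → Param M)
    (A : Matrix (Fin N) (Fin N) ℝ) (μ : Fin N → ℝ) (W₀ : Ω → Stack N M) (n : ℕ) (ω : Ω) :
    atc ghat A μ W₀ (n + 1) ω = diffusionMap J A μ (atc ghat A μ W₀ n ω)
      + (-(bigAT A).comp (bigM μ)) (noise J ghat n ω (atc ghat A μ W₀ n ω)) := by
  set W := atc ghat A μ W₀ n ω
  have hcombine : diffusionMap J A μ W + (-(bigAT A).comp (bigM μ)) (noise J ghat n ω W)
      = bigAT A (W - bigM μ (netGrad J W + noise J ghat n ω W)) := by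
    simp only [diffusionMap, neg_apply, ContinuousLinearMap.comp_apply, map_sub, map_add]
    abel
  have hgrad : netGrad J W + noise J ghat n ω W = col fun k => ghat n ω k (W k) := by
    ext k : 1
    exact add_sub_cancel _ _
  rw [hcombine, hgrad]
  rfl

section Contraction

variable (hJ' : ∀ k, Differentiable ℝ (gradient (J k))) (hwo : ∀ k, gradient (J k) (wo k) = 0)
  (hlam : ∀ k w v, lam k * ‖v‖ ^ 2 ≤ inner ℝ (hess (J k) w v) v)
  (hL : ∀ k w, ‖hess (J k) w‖ ≤ L) {r : ℝ} (hcon : IsSectorContraction M A p lam L μ r)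

include hlam hL hcon in
lemma IsSectorContraction.norm_sqrtWeight_bigB_le (x : Stack N M) :
    ‖sqrtWeight p (bigB A J wo μ x)‖ ≤ r * ‖sqrtWeight p x‖ :=
  hcon x _ (sectorBound_netHess hlam hL (col wo) x)

include hJ' hwo hlam hL hcon

lemma IsSectorContraction.norm_sqrtWeight_diffusionMap_sub_le (hfix : bigAT A (col wo) = col wo)
    (W : Stack N M) :
    ‖sqrtWeight p (diffusionMap J A μ W - col wo)‖ ≤ r * ‖sqrtWeight p (W - col wo)‖ := by
  have hsub : diffusionMap J A μ W - col wo = bigAT A ((W - col wo) - bigM μ (netGrad J W)) := by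
    rw [diffusionMap, sub_right_comm, map_sub (bigAT A) _ (col wo), hfix]
  rw [hsub]
  exact hcon _ _ (sectorBound_netGrad hJ' hwo hlam hL W)

variable [IsProbabilityMeasure P] {q α σ : ℝ} (hq : 0 < q) (hpq : ∀ k, q ≤ p k)
  (hfix : bigAT A (col wo) = col wo) (hr : 0 ≤ r)
  (hnoise : IsRelativeNoise P F (noise J ghat) (col wo) α σ)
  {W₀ : Ω → Stack N M} (hW₀m : StronglyMeasurable[F 0] W₀) (hW₀ : MemLp W₀ 4 P)
include hq hpq hfix hr hnoise hW₀m hW₀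

lemma stronglyMeasurable_and_memLp_four_atc (n : ℕ) :
    StronglyMeasurable[F n] (atc ghat A μ W₀ n) ∧ MemLp (atc ghat A μ W₀ n) 4 P :=
  hnoise.stronglyMeasurable_and_memLp_four (W := atc ghat A μ W₀) (atc_succ J ghat A μ W₀) hW₀m hW₀
    (continuous_diffusionMap hJ')
    (norm_sub_le_of_norm_map_sub_le (by positivity) hr (norm_le_mul_norm_sqrtWeight hq hpq)
      (hcon.norm_sqrtWeight_diffusionMap_sub_le hJ' hwo hlam hL hfix)) n

lemma isMartingaleDifference_noise_atc :
    IsMartingaleDifference P F fun n ω => noise J ghat n ω (atc ghat A μ W₀ n ω) :=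
  have hW := stronglyMeasurable_and_memLp_four_atc hJ' hwo hlam hL hcon hq hpq hfix hr hnoise
    hW₀m hW₀
  hnoise.isMartingaleDifference (fun n => (hW n).1) fun n => (hW n).2

omit hr hcon in
lemma eventually_rms_noise_atc_le {c m : ℝ} (hc : 0 < c) (hm : 0 < m) (hcm : c * m ≤ 1)
    (hcon : IsSectorContraction M A p lam L μ (1 - c * m)) (havg : IsAveraging A p)
    (hp1 : ∀ k, p k ≤ 1) (hμ : ∀ k, |μ k| ≤ m) (hα : 0 ≤ α) (hαm : α / q * m ≤ c / 2) :
    ∀ᶠ n in atTop, rms P (.id ℝ (Stack N M)) (fun ω => noise J ghat n ω (atc ghat A μ W₀ n ω))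
      ≤ √(3 * (σ ^ 2 + 1)) := by
  have hnoiseGain (x : Stack N M) :
      ‖sqrtWeight p ((-(bigAT A).comp (bigM μ)) x)‖ ≤ m * ‖x‖ := by
    rw [neg_apply, map_neg, norm_neg]
    exact havg.norm_sqrtWeight_bigAT_bigM_le (fun k => hq.le.trans (hpq k)) hp1 hm.le hμ x
  have hq2 : α * (√q)⁻¹ ^ 2 = α / q := by rw [inv_pow, Real.sq_sqrt hq.le, div_eq_mul_inv]
  have hrate : (1 - c * m) ^ 2 + m ^ 2 * (α * (√q)⁻¹ ^ 2) ≤ 1 - c * m / 2 := by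
    rw [hq2]
    nlinarith [mul_pos hc hm]
  filter_upwards [hnoise.eventually_rms_sq_le (atc_succ J ghat A μ W₀) hα
    (inv_nonneg.2 (Real.sqrt_nonneg q)) (sub_nonneg.2 hcm) hm (norm_le_mul_norm_sqrtWeight hq hpq)
    (continuous_diffusionMap hJ')
    (hcon.norm_sqrtWeight_diffusionMap_sub_le hJ' hwo hlam hL hfix) hnoiseGain hrate
    (sub_lt_self 1 (by positivity))
    (stronglyMeasurable_and_memLp_four_atc hJ' hwo hlam hL hcon hq hpq hfix (sub_nonneg.2 hcm)
      hnoise hW₀m hW₀)] with n hn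
  refine Real.le_sqrt_of_sq_le (hn.trans ?_)
  have hvariance : α / q * (2 * (m ^ 2 * (σ ^ 2 + 1)) / (1 - (1 - c * m / 2)))
      = α / q * m * (4 * (σ ^ 2 + 1) / c) := by
    field_simp
    ring
  have hσ : c / 2 * (4 * (σ ^ 2 + 1) / c) = 2 * (σ ^ 2 + 1) := by
    field_simp
    ring
  rw [hq2, hvariance]
  linarith [mul_le_mul_of_nonneg_right hαm (by positivity : 0 ≤ 4 * (σ ^ 2 + 1) / c)]

end Contraction

end Iterates

section Models

variable {N G M : ℕ} {Gr : SimpleGraph (Fin N)} {group : Fin N → Fin G}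
  {J : Fin N → Param M → ℝ} {wo : Fin N → Param M} {A : Matrix (Fin N) (Fin N) ℝ}
  {p lam μ : Fin N → ℝ}

lemma lift_bigD (hA : IsCombinationMatrix Gr group A) (hp : IsPerronVector group A p)
    (hμ : stepMax μ ≠ 0) (y : Stack G M) :
    lift group (bigD J wo group p μ y) = groupMean group p (bigB A J wo μ (lift group y)) := by
  have hbigB : bigB A J wo μ (lift group y)
      = bigAT A (lift group y - bigM μ (netHess J (col wo) (lift group y))) := rfl
  rw [hbigB, hA.groupMean_bigAT hp, map_sub, hp.groupMean_lift, ← lift_bigPT]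
  ext k : 1
  change y (group k) - stepMax μ • barH J wo group p μ (group k) (y (group k))
    = y (group k)
      - ∑ l with group l = group k, p l • (μ l • hess (J l) (wo l) (y (group l)))
  rw [barH, sum_apply, Finset.smul_sum]
  congr 1
  refine Finset.sum_congr rfl fun l hl => ?_
  rw [(Finset.mem_filter.1 hl).2, smul_apply, smul_smul, smul_smul, mul_div_cancel₀ _ hμ]

variable {Ω : Type*} {mΩ : MeasurableSpace Ω} {P : Measure Ω} {F : Filtration ℕ mΩ}
  {ghat : ℕ → Ω → Fin N → Param M → Param M} {W : ℕ → Ω → Stack N M}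

lemma lift_lowModel_succ (hA : IsCombinationMatrix Gr group A) (hp : IsPerronVector group A p)
    (hμ : stepMax μ ≠ 0) (W : ℕ → Ω → Stack N M) (Y₀ : Ω → Stack G M) (n : ℕ) (ω : Ω) :
    lift group (lowModel J wo ghat group p μ W Y₀ (n + 1) ω)
      = groupMean group p (bigB A J wo μ (lift group (lowModel J wo ghat group p μ W Y₀ n ω)))
        + groupMean group p (bigM μ (noise J ghat n ω (W n ω))) := by
  rw [← lift_bigD hA hp hμ, ← lift_bigPT]
  rfl

lemma memLp_lift {Y : Ω → Stack G M} {q : ENNReal} (hY : MemLp Y q P) :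
    MemLp (fun ω => lift group (Y ω)) q P :=
  let liftL : Stack G M →L[ℝ] Stack N M :=
    { toFun := lift group
      map_add' := fun _ _ => rfl
      map_smul' := fun _ _ => rfl
      cont := (PiLp.continuous_toLp 2 _).comp
        (continuous_pi fun k => PiLp.continuous_apply 2 _ (group k)) }
  liftL.comp_memLp' hY

lemma memLp_longModel {X₀ : Ω → Stack N M}
    (hS : ∀ n, MemLp (fun ω => noise J ghat n ω (W n ω)) 2 P) (hX₀ : MemLp X₀ 2 P) (n : ℕ) :
    MemLp (longModel J wo ghat A μ W X₀ n) 2 P :=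
  memLp_linearRecursion (fun n => ((bigAT A).comp (bigM μ)).comp_memLp' (hS n)) hX₀
    (fun _ => rfl) n

lemma memLp_lift_lowModel (hA : IsCombinationMatrix Gr group A) (hp : IsPerronVector group A p)
    (hμ : stepMax μ ≠ 0) {Y₀ : Ω → Stack G M}
    (hS : ∀ n, MemLp (fun ω => noise J ghat n ω (W n ω)) 2 P) (hY₀ : MemLp Y₀ 2 P) (n : ℕ) :
    MemLp (fun ω => lift group (lowModel J wo ghat group p μ W Y₀ n ω)) 2 P :=
  memLp_linearRecursion
    (X := fun n ω => lift group (lowModel J wo ghat group p μ W Y₀ n ω))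
    (B := (groupMean group p).comp (bigB A J wo μ))
    (fun n => ((groupMean group p).comp (bigM μ)).comp_memLp' (hS n)) (memLp_lift hY₀)
    (fun n => funext (lift_lowModel_succ hA hp hμ W Y₀ n)) n

lemma norm_sqrtWeight_bigM_netHess_le {L m : ℝ} (hL₀ : 0 ≤ L) (hL : ∀ k w, ‖hess (J k) w‖ ≤ L)
    (hm : 0 ≤ m) (hμ : ∀ k, |μ k| ≤ m) (W x : Stack N M) :
    ‖sqrtWeight p (bigM μ (netHess J W x))‖ ≤ m * L * ‖sqrtWeight p x‖ :=
  calc ‖sqrtWeight p (bigM μ (netHess J W x))‖ ≤ m * ‖sqrtWeight p (netHess J W x)‖ :=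
        norm_sqrtWeight_bigM_le hm hμ _
    _ ≤ m * (L * ‖sqrtWeight p x‖) := by
        gcongr
        exact norm_sqrtWeight_le_of_forall_norm_le hL₀ fun k =>
          ContinuousLinearMap.le_of_opNorm_le _ (hL k (W k)) (x k)
    _ = m * L * ‖sqrtWeight p x‖ := (mul_assoc _ _ _).symm

section FixedStep

variable [IsProbabilityMeasure P] {L c m K : ℝ}
  (hS : IsMartingaleDifference P F fun n ω => noise J ghat n ω (W n ω)) (hK : 0 < K)
  (hSK : ∀ᶠ n in atTop, rms P (.id ℝ (Stack N M)) (fun ω => noise J ghat n ω (W n ω)) ≤ K)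
  (hlam : ∀ k w v, lam k * ‖v‖ ^ 2 ≤ inner ℝ (hess (J k) w v) v)
  (hL : ∀ k w, ‖hess (J k) w‖ ≤ L) (hc : 0 < c) (hm : 0 < m) (hm1 : m ≤ 1) (hcm : c * m ≤ 1)
  (hcon : IsSectorContraction M A p lam L μ (1 - c * m))
  (hnonneg : ∀ k, 0 ≤ p k) (hp1 : ∀ k, p k ≤ 1) (hμ : ∀ k, |μ k| ≤ m)
  {X₀ : Ω → Stack N M} (hX₀ : MemLp X₀ 2 P)
include hS hK hSK hlam hL hc hm hm1 hcm hcon hnonneg hp1 hμ hX₀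

lemma eventually_rms_longModel_le (hA : IsAveraging A p) :
    ∀ᶠ n in atTop, rms P (sqrtWeight p) (longModel J wo ghat A μ W X₀ n)
      ≤ √(2 * K ^ 2 / c) + 1 := by
  have hvar : 2 * (m * K) ^ 2 / (1 - (1 - c * m)) ≤ 2 * K ^ 2 / c :=
    calc 2 * (m * K) ^ 2 / (1 - (1 - c * m)) = m * (2 * K ^ 2 / c) := by
          field_simp
          ring
      _ ≤ 2 * K ^ 2 / c := mul_le_of_le_one_left (by positivity) hm1
  have hnoise : ∀ᶠ n in atTop, rms P (sqrtWeight p)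
      (((bigAT A).comp (bigM μ)) ∘ fun ω => noise J ghat n ω (W n ω)) ≤ m * K := by
    filter_upwards [hSK] with n hn
    refine (rms_le_mul (D₁ := .id ℝ (Stack N M)) hm.le (hS.memLp_two n) fun ω => ?_).trans
      (mul_le_mul_of_nonneg_left hn hm.le)
    exact hA.norm_sqrtWeight_bigAT_bigM_le hnonneg hp1 hm.le hμ _
  filter_upwards [eventually_rms_linearRecursion_le (B := bigB A J wo μ)
    (X := longModel J wo ghat A μ W X₀) (hS.clm_comp ((bigAT A).comp (bigM μ))) hX₀
    (fun _ => rfl) (sub_nonneg.2 hcm) (sub_lt_self 1 (by positivity))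
    (hcon.norm_sqrtWeight_bigB_le hlam hL) (by positivity) hnoise] with n hn
  exact hn.trans (by gcongr)

variable (hA : IsCombinationMatrix Gr group A) (hp : IsPerronVector group A p) (hL₀ : 0 < L)
  {ρ : ℝ} (hρ : 0 ≤ ρ) (hρ' : ρ < 1)
  (hmix : ∀ x : Stack N M, groupMean group p x = 0 →
    ‖sqrtWeight p (bigAT A x)‖ ≤ ρ * ‖sqrtWeight p x‖)
include hA hp hL₀ hρ hρ' hmix

lemma eventually_rms_groupDeviation_longModel_le :
    ∀ᶠ n in atTop, rms P ((sqrtWeight p).comp (groupDeviation group p))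
        (longModel J wo ghat A μ W X₀ n)
      ≤ 2 * (2 * (m * (K + L * (√(2 * K ^ 2 / c) + 1)))) / (1 - ρ) := by
  have hX := memLp_longModel (J := J) (wo := wo) (A := A) (μ := μ) hS.memLp_two hX₀
  refine eventually_rms_groupDeviation_le hA hp hnonneg hρ hρ' hmix hX
    (E := fun n ω => bigM μ (noise J ghat n ω (W n ω))
      - bigM μ (netHess J (col wo) (longModel J wo ghat A μ W X₀ n ω)))
    (fun n => ((bigM μ).comp_memLp' (hS.memLp_two n)).sub
      (((bigM μ).comp (netHess J (col wo))).comp_memLp' (hX n)))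
    (fun n ω => ?_) (by positivity) ?_
  · simp only [longModel, bigB, ContinuousLinearMap.comp_apply, sub_apply,
      ContinuousLinearMap.id_apply, map_add, map_sub]
    abel
  · filter_upwards [hSK, eventually_rms_longModel_le hS hK hSK hlam hL hc hm hm1 hcm hcon hnonneg
      hp1 hμ hX₀ (hA.isAveraging hp)] with n hSn hXn
    refine (rms_le_mul_add_mul (D₁ := .id ℝ (Stack N M)) hm.le (mul_nonneg hm.le hL₀.le)
      (hS.memLp_two n) (hX n) fun ω => ?_).trans
      ((add_le_add (mul_le_mul_of_nonneg_left hSn hm.le)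
        (mul_le_mul_of_nonneg_left hXn (mul_nonneg hm.le hL₀.le))).trans_eq (by ring))
    rw [map_sub]
    refine (norm_sub_le _ _).trans (add_le_add ?_ ?_)
    · refine (norm_sqrtWeight_bigM_le hm.le hμ _).trans ?_
      gcongr
      exact norm_sqrtWeight_le hp1 _
    · exact norm_sqrtWeight_bigM_netHess_le hL₀.le hL hm.le hμ _ _

lemma eventually_rms_longModel_sub_lift_lowModel_le (hμ' : stepMax μ ≠ 0) {Y₀ : Ω → Stack G M}
    (hY₀ : MemLp Y₀ 2 P) :
    ∀ᶠ n in atTop, rms P (sqrtWeight p) (fun ω => longModel J wo ghat A μ W X₀ n ω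
        - lift group (lowModel J wo ghat group p μ W Y₀ n ω))
      ≤ (2 * L / c + 1) * (4 * (K + L * (√(2 * K ^ 2 / c) + 1)) / (1 - ρ)) * m := by
  set δ := 2 * (2 * (m * (K + L * (√(2 * K ^ 2 / c) + 1)))) / (1 - ρ) with hδ
  have hδ₀ : 0 < δ := div_pos (by positivity) (sub_pos.2 hρ')
  have hbound : 2 * (m * L * δ) / (1 - (1 - c * m)) + δ
      = (2 * L / c + 1) * (4 * (K + L * (√(2 * K ^ 2 / c) + 1)) / (1 - ρ)) * m := by
    have hgap := (sub_pos.2 hρ').ne'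
    rw [hδ]
    field_simp
    ring
  have hmean (n : ℕ) (ω : Ω) : groupMean group p (longModel J wo ghat A μ W X₀ (n + 1) ω
        - lift group (lowModel J wo ghat group p μ W Y₀ (n + 1) ω))
      = groupMean group p (bigB A J wo μ (longModel J wo ghat A μ W X₀ n ω
        - lift group (lowModel J wo ghat group p μ W Y₀ n ω))) := by
    simp only [lift_lowModel_succ hA hp hμ', longModel, map_add, map_sub,
      hp.groupMean_groupMean, hA.groupMean_bigAT hp]
    abel
  rw [← hbound]
  refine eventually_rms_le_of_groupMean_succ hA hp hnonneg (T := (bigM μ).comp (netHess J (col wo)))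
    (sub_nonneg.2 hcm) (sub_lt_self 1 (by positivity)) (by positivity)
    (hcon.norm_sqrtWeight_bigB_le hlam hL)
    (norm_sqrtWeight_bigM_netHess_le hL₀.le hL hm.le hμ (col wo))
    (fun n => (memLp_longModel hS.memLp_two hX₀ n).sub
      (memLp_lift_lowModel hA hp hμ' hS.memLp_two hY₀ n))
    hmean hδ₀ ?_
  filter_upwards [eventually_rms_groupDeviation_longModel_le (wo := wo) hS hK hSK hlam hL hc hm
    hm1 hcm hcon hnonneg hp1 hμ hX₀ hA hp hL₀ hρ hρ' hmix] with n hn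
  refine le_of_eq_of_le ?_ hn
  simp only [rms, Function.comp_def, ContinuousLinearMap.comp_apply, Pi.sub_apply, map_sub,
    hp.groupDeviation_lift, map_zero, sub_zero]

end FixedStep

end Models

section Accuracy

variable {Ω : Type*} {mΩ : MeasurableSpace Ω} {P : Measure Ω} [IsProbabilityMeasure P]
  {F : Filtration ℕ mΩ} {N G M : ℕ} {Gr : SimpleGraph (Fin N)} {group : Fin N → Fin G}
  {J : Fin N → Param M → ℝ} {wo : Fin N → Param M} {ghat : ℕ → Ω → Fin N → Param M → Param M}
  {A : Matrix (Fin N) (Fin N) ℝ} {p lam : Fin N → ℝ} {L α σ τ : ℝ}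

lemma exists_pos_norm_hess_le (hJ : ∀ k, Differentiable ℝ (J k))
    (hJ' : ∀ k, Differentiable ℝ (gradient (J k))) {lamL lamU : Fin N → ℝ} (hlam : ∀ k, 0 ≤ lamL k)
    (hbounds : ∀ k w v, lamL k * ‖v‖ ^ 2 ≤ inner ℝ (hess (J k) w v) v ∧
      inner ℝ (hess (J k) w v) v ≤ lamU k * ‖v‖ ^ 2) :
    ∃ L : ℝ, 0 < L ∧ ∀ k w, ‖hess (J k) w‖ ≤ L := by
  have : 0 ≤ ∑ l, |lamU l| := Finset.sum_nonneg fun l _ => abs_nonneg _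
  refine ⟨1 + ∑ l, |lamU l|, by positivity, fun k w => norm_hess_le (hJ k) (hJ' k) (by positivity)
    (fun v => (mul_nonneg (hlam k) (sq_nonneg _)).trans (hbounds k w v).1) fun v =>
    (hbounds k w v).2.trans (mul_le_mul_of_nonneg_right ?_ (sq_nonneg _))⟩
  have hk : |lamU k| ≤ ∑ l, |lamU l| :=
    Finset.single_le_sum (f := fun l => |lamU l|) (fun l _ => abs_nonneg _) (Finset.mem_univ k)
  linarith [le_abs_self (lamU k)]

theorem exists_eventually_lintegral_longModel_sub_lift_lowModel_le
    (hconn : ∀ m, (Gr.induce {k | group k = m}).Connected)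
    (hgroup : ∀ k l, group k = group l → wo k = wo l) (hwo : ∀ k, gradient (J k) (wo k) = 0)
    (hJ' : ∀ k, Differentiable ℝ (gradient (J k))) (hlam₀ : ∀ k, 0 ≤ lam k)
    (hlam : ∀ k w v, lam k * ‖v‖ ^ 2 ≤ inner ℝ (hess (J k) w v) v)
    (hlam' : ∀ m, ∃ k, group k = m ∧ 0 < lam k) (hL₀ : 0 < L) (hL : ∀ k w, ‖hess (J k) w‖ ≤ L)
    (hα : 0 ≤ α) (hnoise : IsRelativeNoise P F (noise J ghat) (col wo) α σ)
    (hA : IsCombinationMatrix Gr group A) (hp : IsPerronVector group A p) (hτ : 0 < τ) :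
    ∃ C : ℝ, ∀ᶠ m in 𝓝[>] (0 : ℝ), ∀ μ : Fin N → ℝ, (∀ k, μ k ∈ Set.Icc (τ * m) m) →
      stepMax μ = m → ∀ (W₀ X₀ : Ω → Stack N M) (Y₀ : Ω → Stack G M),
        StronglyMeasurable[F 0] W₀ → MemLp W₀ 4 P → MemLp X₀ 2 P → MemLp Y₀ 2 P →
        ∀ᶠ n in atTop, ∫⁻ ω, ‖longModel J wo ghat A μ (atc ghat A μ W₀) X₀ n ω
            - lift group (lowModel J wo ghat group p μ (atc ghat A μ W₀) Y₀ n ω)‖ₑ ^ 2 ∂P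
          ≤ ENNReal.ofReal ((C * m) ^ 2) := by
  have hpos := hp.pos hA hconn
  have hnonneg := hp.nonneg hA hconn
  have hp1 := hp.le_one hnonneg
  have hfix : bigAT A (col wo) = col wo := hA.bigAT_eq_self hgroup
  obtain ⟨q, hpq, hq⟩ : ∃ q, (∀ k, q ≤ p k) ∧ 0 < q :=
    ((eventually_all.2 fun k => (eventually_le_nhds (hpos k)).filter_mono
      nhdsWithin_le_nhds).and self_mem_nhdsWithin : ∀ᶠ q in 𝓝[>] (0 : ℝ), _).exists
  obtain ⟨ρ, hρ, hρ', hmix⟩ := exists_lt_one_norm_sqrtWeight_bigAT_le hA hp hconn M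
  obtain ⟨c, hc, hcon⟩ :=
    exists_eventually_isSectorContraction hA hp hconn M hlam₀ hlam' hL₀.le hτ
  set K := √(3 * (σ ^ 2 + 1))
  have hK : 0 < K := Real.sqrt_pos.2 (by positivity)
  have : 0 < 1 - ρ := sub_pos.2 hρ'
  refine ⟨(√q)⁻¹ * ((2 * L / c + 1) * (4 * (K + L * (√(2 * K ^ 2 / c) + 1)) / (1 - ρ))), ?_⟩
  filter_upwards [hcon, eventually_mul_le_nhdsGT_zero (α / q) (half_pos hc),
    eventually_mul_le_nhdsGT_zero 1 one_pos, self_mem_nhdsWithin]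
    with m ⟨hcm, hcon⟩ hαm hm1 (hm : 0 < m) μ hμ hmax W₀ X₀ Y₀ hW₀m hW₀ hX₀ hY₀
  rw [one_mul] at hm1
  have habs (k : Fin N) : |μ k| ≤ m :=
    (abs_of_nonneg ((mul_pos hτ hm).le.trans (hμ k).1)).trans_le (hμ k).2
  have hS := isMartingaleDifference_noise_atc hJ' hwo hlam hL (hcon μ hμ) hq hpq hfix
    (sub_nonneg.2 hcm) hnoise hW₀m hW₀
  have hmax' : stepMax μ ≠ 0 := hmax.trans_ne hm.ne'
  have hSK := eventually_rms_noise_atc_le hJ' hwo hlam hL hq hpq hfix hnoise hW₀m hW₀ hc hm hcm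
    (hcon μ hμ) (hA.isAveraging hp) hp1 habs hα hαm
  filter_upwards [eventually_rms_longModel_sub_lift_lowModel_le (wo := wo) hS hK hSK hlam hL hc hm
    hm1 hcm (hcon μ hμ) hnonneg hp1 habs hX₀ hA hp hL₀ hρ hρ' hmix hmax' hY₀] with n hn
  have hmem : MemLp (fun ω => longModel J wo ghat A μ (atc ghat A μ W₀) X₀ n ω
      - lift group (lowModel J wo ghat group p μ (atc ghat A μ W₀) Y₀ n ω)) 2 P :=
    (memLp_longModel hS.memLp_two hX₀ n).sub
      (memLp_lift_lowModel hA hp hmax' hS.memLp_two hY₀ n)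
  rw [lintegral_enorm_sq_eq_rms_sq hmem]
  refine ENNReal.ofReal_le_ofReal (pow_le_pow_left₀ (rms_nonneg _ _)
    ((rms_le_mul (inv_nonneg.2 (Real.sqrt_nonneg q)) hmem fun ω =>
      norm_le_mul_norm_sqrtWeight hq hpq _).trans ?_) 2)
  rw [mul_assoc]
  gcongr

end Accuracy
end ClusterNet

theorem mainTheorem7_general {Ω : Type*} {mΩ : MeasurableSpace Ω} (P : Measure Ω)
    [IsProbabilityMeasure P] (F : Filtration ℕ mΩ) {N G M : ℕ} (Gr : SimpleGraph (Fin N))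
    (group : Fin N → Fin G) (J : Fin N → ClusterNet.Param M → ℝ) (wo : Fin N → ClusterNet.Param M)
    (ghat : ℕ → Ω → Fin N → ClusterNet.Param M → ClusterNet.Param M)
    (A : Matrix (Fin N) (Fin N) ℝ) (p : Fin N → ℝ)
    (hconn : ∀ m, (Gr.induce {k | group k = m}).Connected)
    (hgroup : ∀ k l, group k = group l → wo k = wo l) (hwo : ∀ k, gradient (J k) (wo k) = 0)
    (hJ : ∀ k, Differentiable ℝ (J k)) (hJ' : ∀ k, Differentiable ℝ (gradient (J k)))
    (lamL lamU : Fin N → ℝ) (hlam : ∀ k, 0 ≤ lamL k)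
    (hbounds : ∀ k w v, lamL k * ‖v‖ ^ 2 ≤ inner ℝ (ClusterNet.hess (J k) w v) v ∧
      inner ℝ (ClusterNet.hess (J k) w v) v ≤ lamU k * ‖v‖ ^ 2)
    (hlam' : ∀ m, ∃ k, group k = m ∧ 0 < lamL k) (α σ : ℝ) (hα : 0 ≤ α)
    (hnoise : ClusterNet.IsRelativeNoise P F (ClusterNet.noise J ghat) (ClusterNet.col wo) α σ)
    (hA : ClusterNet.IsCombinationMatrix Gr group A) (hp : ClusterNet.IsPerronVector group A p)
    (τ : ℝ) (hτ : 0 < τ) :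
    ∃ μ₀ C : ℝ, 0 < μ₀ ∧ 0 ≤ C ∧
      ∀ μ : Fin N → ℝ, (∀ k, 0 < μ k) → (∀ k, τ * ClusterNet.stepMax μ ≤ μ k) →
        ClusterNet.stepMax μ ≤ μ₀ →
      ∀ (W₀ X₀ : Ω → ClusterNet.Stack N M) (Y₀ : Ω → ClusterNet.Stack G M),
        StronglyMeasurable[F 0] W₀ → MemLp W₀ 4 P → MemLp X₀ 2 P → MemLp Y₀ 2 P →
        limsup (fun n => ∫⁻ ω,
            ‖ClusterNet.longModel J wo ghat A μ (ClusterNet.atc ghat A μ W₀) X₀ n ω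
              - ClusterNet.lift group (ClusterNet.lowModel J wo ghat group p μ
                  (ClusterNet.atc ghat A μ W₀) Y₀ n ω)‖ₑ ^ 2 ∂P) atTop
          ≤ ENNReal.ofReal (C * ClusterNet.stepMax μ ^ 2) := by
  obtain ⟨L, hL₀, hL⟩ := ClusterNet.exists_pos_norm_hess_le hJ hJ' hlam hbounds
  obtain ⟨C, hC⟩ := ClusterNet.exists_eventually_lintegral_longModel_sub_lift_lowModel_le hconn
    hgroup hwo hJ' hlam (fun k w v => (hbounds k w v).1) hlam' hL₀ hL hα hnoise hA hp hτ
  obtain ⟨μ₀, hμ₀, hsmall⟩ := mem_nhdsGT_iff_exists_Ioc_subset.1 hC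
  refine ⟨μ₀, C ^ 2, hμ₀, sq_nonneg C, fun μ hpos hcomp hle W₀ X₀ Y₀ hW₀m hW₀ hX₀ hY₀ => ?_⟩
  rw [← mul_pow]
  refine limsup_le_of_le (by isBoundedDefault) ?_
  rcases isEmpty_or_nonempty (Fin N) with hN | ⟨⟨k⟩⟩
  · exact Eventually.of_forall fun n => by simp [Subsingleton.elim _ (0 : ClusterNet.Stack N M)]
  · have hmax (k : Fin N) : μ k ≤ ClusterNet.stepMax μ :=
      le_ciSup (Set.finite_range μ).bddAbove k
    exact hsmall ⟨(hpos k).trans_le (hmax k), hle⟩ μ (fun k => ⟨hcomp k, hmax k⟩) rfl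
      W₀ X₀ Y₀ hW₀m hW₀ hX₀ hY₀

theorem mainTheorem7 {Ω : Type*} {mΩ : MeasurableSpace Ω} (P : Measure Ω) [IsProbabilityMeasure P]
    (F : Filtration ℕ mΩ) {N Q G M : ℕ}
    (Gr : SimpleGraph (Fin N)) (cluster : Fin N → Fin Q) (group : Fin N → Fin G)
    (J : Fin N → ClusterNet.Param M → ℝ) (wo : Fin N → ClusterNet.Param M)
    (ghat : ℕ → Ω → Fin N → ClusterNet.Param M → ClusterNet.Param M)
    (A : Matrix (Fin N) (Fin N) ℝ) (p : Fin N → ℝ)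
    (hTop : ClusterNet.TopologyAssumption Gr wo cluster group)
    (hCost : ClusterNet.CostAssumption J wo group)
    (hNoise : ClusterNet.NoiseAssumption P F J wo ghat)
    (hA : ClusterNet.IsCombinationMatrix Gr group A)
    (hp : ClusterNet.IsPerronVector group A p)
    (τ : ℝ) (hτ : 0 < τ) :
    ∃ μ₀ C : ℝ, 0 < μ₀ ∧ 0 ≤ C ∧
      ∀ μ : Fin N → ℝ, (∀ k, 0 < μ k) → (∀ k, τ * ClusterNet.stepMax μ ≤ μ k) →
        ClusterNet.stepMax μ ≤ μ₀ →
      ∀ (W₀ X₀ : Ω → ClusterNet.Stack N M) (Y₀ : Ω → ClusterNet.Stack G M),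
        StronglyMeasurable[F 0] W₀ → MemLp W₀ 4 P → MemLp X₀ 2 P → MemLp Y₀ 2 P →
        limsup (fun n => ∫⁻ ω,
            ‖ClusterNet.longModel J wo ghat A μ (ClusterNet.atc ghat A μ W₀) X₀ n ω
              - ClusterNet.lift group (ClusterNet.lowModel J wo ghat group p μ
                  (ClusterNet.atc ghat A μ W₀) Y₀ n ω)‖ₑ ^ 2 ∂P) atTop
          ≤ ENNReal.ofReal (C * ClusterNet.stepMax μ ^ 2) := by
  obtain ⟨lamL, lamU, hlam, hbounds, hlam'⟩ := hCost.hess_bounds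
  obtain ⟨α, σ, hα, hnoise⟩ := hNoise.exists_isRelativeNoise
  exact mainTheorem7_general P F Gr group J wo ghat A p hTop.group_connected
    (fun k l h => (hTop.cluster_iff k l).1 (hTop.group_le_cluster k l h))
    (fun k => ClusterNet.gradient_eq_zero_of_forall_le (hCost.minimizer k)) hCost.differentiable
    hCost.twice_differentiable lamL lamU (fun k => (hlam k).1) hbounds hlam' α σ hα hnoise hA hp
    τ hτ
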